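/- **Setting.** A base station (BS) with $M$ antennas serves $K$ single-antenna users, $K<M$. A fraction $\alpha_{\rm WET}>0$ of each frame is used for downlink energy transfer, a fraction $\alpha_{\rm WIT}>0$ for uplink information transfer, and the rest ($\alpha_{\rm WET}+\alpha_{\rm WIT}<1$) for training; $B>0$ is the bandwidth and $\sigma^2>0$ the noise variance. The channel of user $i$ is ${\bf g}_i=\sqrt{\beta_i}\,{\bf h}_i\in\mathbb C^M$ with $\beta_i>0$, where all entries of ${\bf h}_1,\dots,{\bf h}_K$ are i.i.d. $\mathcal{CN}(0,1)$. *Downlink.* The BS, knowing the channel, sends ${\bf w}_{\rm dl}s$ with ${\bf w}_{\rm dl}=\sum_j\sqrt{\zeta_j}\,{\bf g}_j/\|{\bf g}_j\|$, $\zeta_j>0$, $\sum_j\zeta_j=1$, where $s$ is independent of the channel and $\mathbb E|s|^2=p_{\rm dl}>0$; put $P_{\rm dl}=\alpha_{\rm WET}Bp_{\rm dl}$. Ignoring noise, user $i$ receives $y_i={\bf g}_i^{\rm H}{\bf w}_{\rm dl}s$, with average received energy $\bar\gamma_i=\alpha_{\rm WET}\mathbb E|y_i|^2$. With efficiency $\eta_{\rm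 EH}\in(0,1]$ and thresholds $0<\theta_{\rm act}\le\theta_{\rm sat}<\infty$, the average harvested energy is $$\bar\delta_i=\eta_{\rm EH}\bar\gamma_i\,\mathbb 1\!\left[\tfrac{\theta_{\rm act}}B\le\bar\gamma_i<\tfrac{\theta_{\rm sat}}B\right]+\tfrac{\eta_{\rm EH}\theta_{\rm sat}}B\,\mathbb 1\!\left[\bar\gamma_i\ge\tfrac{\theta_{\rm sat}}B\right].$$ *Uplink.* User $i$ keeps a fraction $\xi_i\in(0,1)$ of the harvested energy for pilots and sends data symbols with average energy $p^i_{\rm ul}=\eta_{\rm PA}(1-\xi_i)\bar\delta_i/\alpha_{\rm WIT}$, where $\eta_{\rm PA}\in(0,1]$. With ${\bf G}=[{\bf g}_1,\dots,{\bf g}_K]$, the BS detects user $i$ with the zero-forcing vector ${\bf a}_i$, the $i$th column of ${\bf G}({\bf G}^{\rm H}{\bf G})^{-1}$, so that $$\mathrm{SINR}_i=\frac{p^i_{\rm ul}|{\bf a}_i^{\rm H}{\bf g}_i|^2}{\sum_{j\ne i}p^j_{\rm ul}|{\bf a}_i^{\rm H}{\bf g}_j|^2+\sigma^2\|{\bf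 a}_i\|^2}.$$ The ergodic rate of user $i$ is $\mathbb E[\alpha_{\rm WIT}B\log_2(1+\mathrm{SINR}_i)]$. Its achievable rate is the Jensen bound $R_i=\alpha_{\rm WIT}B\log_2\!\big(1+1/\mathbb E[1/\mathrm{SINR}_i]\big)$, with $1/0=\infty$ and $1/\infty=0$. Let $$M_{{\rm act},i}=\Big\lceil1+\tfrac1{\zeta_i}\Big(\tfrac{\theta_{\rm act}}{\beta_iP_{\rm dl}}-1\Big)\Big\rceil,\qquad M_{{\rm sat},i}=\Big\lceil1+\tfrac1{\zeta_i}\Big(\tfrac{\theta_{\rm sat}}{\beta_iP_{\rm dl}}-1\Big)\Big\rceil .$$ **Lemma.** For every user $i$, $\mathbb E|y_i|^2$ is finite and $\bar\gamma_i=\alpha_{\rm WET}p_{\rm dl}\beta_i(\zeta_iM+1-\zeta_i)$; the ergodic rate of user $i$ is finite and at least $R_i$; and $$R_i=\begin{cases}0,&M<M_{{\rm act},i},\\[2pt] \alpha_{\rm WIT}B\log_2\!\Big(1+(1-\xi_i)\beta_i\,\eta_{\rm PA}\dfrac{\eta_{\rm EH}\bar\gamma_i}{\alpha_{\rm WIT}\sigma^2}(M-K)\Big),&M_{{\rm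 act},i}\le M<M_{{\rm sat},i},\\[6pt] \alpha_{\rm WIT}B\log_2\!\Big(1+(1-\xi_i)\beta_i\,\eta_{\rm PA}\dfrac{\eta_{\rm EH}\theta_{\rm sat}}{B\alpha_{\rm WIT}\sigma^2}(M-K)\Big),&M\ge M_{{\rm sat},i}.\end{cases}$$ If $\zeta_i=\frac1K$ and $M_{{\rm act},i}\le M<M_{{\rm sat},i}$, then $R_i=\alpha_{\rm WIT}B\log_2\!\big(1+\rho_i(M-K)\big(1+\tfrac{M-1}K\big)\big)$, where $$\rho_i=\frac{(1-\xi_i)\,p_{\rm dl}\,\alpha_{\rm WET}\,\eta_{\rm EH}\,\eta_{\rm PA}\,\beta_i^2}{\alpha_{\rm WIT}\sigma^2}=\frac{P_{\rm dl}(1-\xi_i)\,\eta_{\rm EH}\,\eta_{\rm PA}\,\beta_i^2}{B\,\alpha_{\rm WIT}\sigma^2}.$$ -/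

import Mathlib

open MeasureTheory ProbabilityTheory

namespace WirelessPower

/-- The law `CN(0,1)` on `ℂ`: independent real and imaginary parts, each `N(0, 1/2)`. -/
noncomputable def stdComplexGaussian : Measure ℂ :=
  ((gaussianReal 0 (1 / 2)).prod (gaussianReal 0 (1 / 2))).map
    (fun p : ℝ × ℝ => (⟨p.1, p.2⟩ : ℂ))

/-- Numerical parameters of a wireless-powered system with `K` users (data only). -/
structure Params (K : ℕ) where
  /-- system bandwidth -/
  B : ℝ
  /-- fraction of the frame used for downlink wireless energy transfer -/
  αWET : ℝ
  /-- fraction of the frame used for uplink wireless information transfer -/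
  αWIT : ℝ
  /-- average downlink transmit symbol energy (joules/symbol) -/
  pdl : ℝ
  /-- noise variance `σ²` at the base station -/
  σ2 : ℝ
  /-- harvester activation threshold (watts) -/
  θact : ℝ
  /-- harvester saturation threshold (watts) -/
  θsat : ℝ
  /-- rectifier efficiency of the harvester -/
  ηEH : ℝ
  /-- power amplifier efficiency at the users -/
  ηPA : ℝ
  /-- fraction of the downlink transmit energy allocated to each user -/
  ζ : Fin K → ℝ
  /-- large-scale channel gain of each user -/
  β : Fin K → ℝ
  /-- fraction of the harvested energy that each user reserves for pilots -/
  ξ : Fin K → ℝ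

variable {M K : ℕ} {Ω : Type*}

/-- Average downlink transmit power `P_dl = α_WET B p_dl` (watts). -/
noncomputable def Params.Pdl (P : Params K) : ℝ := P.αWET * P.B * P.pdl

/-- The channel vector `g_i = √β_i h_i`, where `h i j` is the small-scale fading coefficient
between user `i` and antenna `j`. -/
noncomputable def chan (P : Params K) (h : Fin K → Fin M → Ω → ℂ) (i : Fin K) (ω : Ω) :
    EuclideanSpace ℂ (Fin M) :=
  WithLp.toLp 2 fun j => (Real.sqrt (P.β i) : ℂ) * h i j ω

/-- The downlink precoder `w_dl = ∑ j, √ζ_j g_j / ‖g_j‖`. -/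
noncomputable def precoder (P : Params K) (h : Fin K → Fin M → Ω → ℂ) (ω : Ω) :
    EuclideanSpace ℂ (Fin M) :=
  ∑ j, ((Real.sqrt (P.ζ j) / ‖chan P h j ω‖ : ℝ) : ℂ) • chan P h j ω

/-- The (noise-free) signal `y_i = g_iᴴ w_dl s` received by user `i` on the downlink. -/
noncomputable def rxSignal (P : Params K) (h : Fin K → Fin M → Ω → ℂ) (s : Ω → ℂ)
    (i : Fin K) (ω : Ω) : ℂ :=
  inner ℂ (chan P h i ω) (precoder P h ω) * s ω

/-- Average received energy `γ̄_i = α_WET 𝔼|y_i|²`. -/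
noncomputable def rxEnergy [MeasurableSpace Ω] (μ : Measure Ω) (P : Params K)
    (h : Fin K → Fin M → Ω → ℂ) (s : Ω → ℂ) (i : Fin K) : ℝ :=
  P.αWET * ∫ ω, ‖rxSignal P h s i ω‖ ^ 2 ∂μ

/-- Average energy harvested from an average incident energy `γ`, for the piecewise linear
harvester: nothing below activation, linear up to saturation, constant afterwards. -/
noncomputable def harvest (P : Params K) (γ : ℝ) : ℝ :=
  Set.indicator (Set.Ico (P.θact / P.B) (P.θsat / P.B)) (fun x => P.ηEH * x) γ
    + Set.indicator (Set.Ici (P.θsat / P.B)) (fun _ => P.ηEH * P.θsat / P.B) γ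

/-- Uplink data symbol energy of user `i`, drawn from the harvested energy. -/
noncomputable def ulEnergy [MeasurableSpace Ω] (μ : Measure Ω) (P : Params K)
    (h : Fin K → Fin M → Ω → ℂ) (s : Ω → ℂ) (i : Fin K) : ℝ :=
  P.ηPA * (1 - P.ξ i) * harvest P (rxEnergy μ P h s i) / P.αWIT

/-- The channel matrix `G = [g_1, …, g_K]`. -/
noncomputable def chanMatrix (P : Params K) (h : Fin K → Fin M → Ω → ℂ) (ω : Ω) :
    Matrix (Fin M) (Fin K) ℂ :=
  Matrix.of fun j i => chan P h i ω j

/-- The zero-forcing receive vector of user `i`: the `i`-th column of `G (Gᴴ G)⁻¹`. -/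
noncomputable def zfVector (P : Params K) (h : Fin K → Fin M → Ω → ℂ) (i : Fin K) (ω : Ω) :
    EuclideanSpace ℂ (Fin M) :=
  WithLp.toLp 2 fun j =>
    (chanMatrix P h ω * ((chanMatrix P h ω).conjTranspose * chanMatrix P h ω)⁻¹) j i

/-- Uplink signal-to-interference-plus-noise ratio of user `i` after zero-forcing detection, when
the users transmit with symbol energies `p`:
`p_i |a_iᴴ g_i|² / (∑_{j ≠ i} p_j |a_iᴴ g_j|² + σ² ‖a_i‖²)`. -/
noncomputable def sinr (P : Params K) (h : Fin K → Fin M → Ω → ℂ) (p : Fin K → ℝ)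
    (i : Fin K) (ω : Ω) : ℝ :=
  p i * ‖inner ℂ (zfVector P h i ω) (chan P h i ω)‖ ^ 2 /
    (∑ j ∈ Finset.univ.erase i, p j * ‖inner ℂ (zfVector P h i ω) (chan P h j ω)‖ ^ 2
      + P.σ2 * ‖zfVector P h i ω‖ ^ 2)

/-- Uplink rate of user `i` for the current channel realization. -/
noncomputable def instRate [MeasurableSpace Ω] (μ : Measure Ω) (P : Params K)
    (h : Fin K → Fin M → Ω → ℂ) (s : Ω → ℂ) (i : Fin K) (ω : Ω) : ℝ :=
  P.αWIT * P.B * Real.logb 2 (1 + sinr P h (ulEnergy μ P h s) i ω)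

/-- Ergodic uplink rate of user `i`. -/
noncomputable def ergodicRate [MeasurableSpace Ω] (μ : Measure Ω) (P : Params K)
    (h : Fin K → Fin M → Ω → ℂ) (s : Ω → ℂ) (i : Fin K) : ℝ :=
  ∫ ω, instRate μ P h s i ω ∂μ

/-- The uplink achievable rate `R_i = α_WIT B log₂ (1 + 1 / 𝔼[1 / SINR_i])`, that is, Jensen's bound
for the convex function `x ↦ log₂ (1 + 1 / x)` at `x = 1 / SINR_i`. The inner expectation is taken
in `[0, ∞]`, so that a vanishing SINR gives `1 / 𝔼[1 / SINR_i] = 1 / ∞ = 0`. -/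
noncomputable def achievableRate [MeasurableSpace Ω] (μ : Measure Ω) (P : Params K)
    (h : Fin K → Fin M → Ω → ℂ) (s : Ω → ℂ) (i : Fin K) : ℝ :=
  P.αWIT * P.B * Real.logb 2
    (1 + (∫⁻ ω, (ENNReal.ofReal (sinr P h (ulEnergy μ P h s) i ω))⁻¹ ∂μ)⁻¹.toReal)

/-- Number of antennas needed to bring the average received power of user `i` to the level `θ`. -/
noncomputable def antennaThreshold (P : Params K) (θ : ℝ) (i : Fin K) : ℤ :=
  ⌈1 + 1 / P.ζ i * (θ / (P.β i * P.Pdl) - 1)⌉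

/-- `M_{act,i}`. -/
noncomputable def Mact (P : Params K) (i : Fin K) : ℤ := antennaThreshold P P.θact i

/-- `M_{sat,i}`. -/
noncomputable def Msat (P : Params K) (i : Fin K) : ℤ := antennaThreshold P P.θsat i

/-- `ρ_i`. -/
noncomputable def rho (P : Params K) (i : Fin K) : ℝ :=
  (1 - P.ξ i) * P.pdl * P.αWET * P.ηEH * P.ηPA * P.β i ^ 2 / (P.αWIT * P.σ2)

end WirelessPower

/-!
The channels form a family of independent isotropic complex Gaussian vectors. Flipping the sign of
one of them preserves the joint law, so the gains of distinct beams are uncorrelated: the received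
power is `ζ_i 𝔼‖g_i‖² = ζ_i M β_i` from the user's own beam plus `ζ_j β_i` from each other beam,
whose direction is independent of `g_i`.

The zero-forcing vector `a_i` is the dual vector of `g_i`, so interference vanishes and `SINR_i` is
`p_i / (σ² ‖a_i‖²)`. Since `1 / ‖a_i‖` is the length of the projection of `g_i` onto the orthogonal
complement of the other channels, a complex Gaussian vector in dimension `d = M - K + 1`, the mean
of `‖a_i‖²` is an inverse moment. Writing `1 / a = ∫₀^∞ exp (-t a) dt` reduces it to the Gaussian
Laplace transform and gives `1 / (β_i (d - 1))`. The lower bound on the ergodic rate integrates the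
tangent inequality of the convex function `x ↦ log (1 + 1 / x)`.
-/

namespace WirelessPower

section StdGaussian

variable {E : Type*} [NormedAddCommGroup E] [InnerProductSpace ℝ E] [FiniteDimensional ℝ E]
  [MeasurableSpace E] [BorelSpace E]

lemma integral_exp_neg_mul_sq_gaussianReal {t : ℝ} (ht : 0 ≤ t) :
    ∫ x, Real.exp (-t * x ^ 2) ∂gaussianReal 0 1 = (√(1 + 2 * t))⁻¹ := by
  rw [integral_gaussianReal_eq_integral_smul one_ne_zero]
  have density_mul (x : ℝ) : gaussianPDFReal 0 1 x • Real.exp (-t * x ^ 2)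
      = (√(2 * Real.pi))⁻¹ * Real.exp (-((1 + 2 * t) / 2) * x ^ 2) := by
    rw [gaussianPDFReal_def, smul_eq_mul, mul_assoc, ← Real.exp_add]
    simp only [NNReal.coe_one]
    ring_nf
  simp only [density_mul]
  rw [integral_const_mul, integral_gaussian, ← Real.sqrt_inv, ← Real.sqrt_mul (by positivity),
    ← Real.sqrt_inv]
  congr 1
  field_simp

lemma integral_exp_neg_mul_norm_sq_stdGaussian {t : ℝ} (ht : 0 ≤ t) :
    ∫ x, Real.exp (-t * ‖x‖ ^ 2) ∂stdGaussian E = (√(1 + 2 * t))⁻¹ ^ Module.finrank ℝ E := by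
  have norm_sq_sum (x : Fin (Module.finrank ℝ E) → ℝ) :
      ‖∑ k, x k • stdOrthonormalBasis ℝ E k‖ ^ 2 = ∑ k, x k ^ 2 := by
    rw [← OrthonormalBasis.sum_sq_norm_inner_right (stdOrthonormalBasis ℝ E)]
    simp [(stdOrthonormalBasis ℝ E).orthonormal.inner_right_fintype]
  rw [stdGaussian, integral_map (Measurable.aemeasurable (by fun_prop)) (by fun_prop)]
  simp only [norm_sq_sum, Finset.mul_sum, Real.exp_sum]
  rw [integral_fintype_prod_eq_pow (fun x : ℝ => Real.exp (-t * x ^ 2)),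
    integral_exp_neg_mul_sq_gaussianReal ht, Fintype.card_fin]

lemma lintegral_exp_neg_mul {a : ℝ} (ha : 0 ≤ a) :
    ∫⁻ t in Set.Ioi (0 : ℝ), ENNReal.ofReal (Real.exp (-t * a)) = (ENNReal.ofReal a)⁻¹ := by
  rcases ha.eq_or_lt with rfl | ha
  · simp
  have exp_eq (t : ℝ) : Real.exp (-t * a) = Real.exp (-a * t) := by rw [neg_mul_comm, mul_comm]
  simp only [exp_eq]
  rw [← ofReal_integral_eq_lintegral_ofReal (integrableOn_exp_mul_Ioi (neg_lt_zero.2 ha) 0)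
    (ae_of_all _ fun t => (Real.exp_pos _).le),
    integral_exp_mul_Ioi (neg_lt_zero.2 ha), ← ENNReal.ofReal_inv_of_pos ha]
  simp

lemma lintegral_inv_sqrt_one_add_pow {d : ℕ} (hd : 2 < d) :
    ∫⁻ t in Set.Ioi (0 : ℝ), ENNReal.ofReal ((√(1 + 2 * t))⁻¹ ^ d)
      = ENNReal.ofReal ((d : ℝ) - 2)⁻¹ := by
  have hd' : (2 : ℝ) < d := by exact_mod_cast hd
  have tendsto_primitive : Filter.Tendsto
      (fun t : ℝ => -((d : ℝ) - 2)⁻¹ * (1 + 2 * t) ^ (-(((d : ℝ) - 2) / 2))) Filter.atTop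
      (nhds (-((d : ℝ) - 2)⁻¹ * 0)) :=
    ((tendsto_rpow_neg_atTop (by linarith)).comp (Filter.tendsto_atTop_add_const_left _ _
      (Filter.tendsto_id.const_mul_atTop two_pos))).const_mul _
  have hasDerivAt_primitive : ∀ t ∈ Set.Ici (0 : ℝ), HasDerivAt
      (fun t : ℝ => -((d : ℝ) - 2)⁻¹ * (1 + 2 * t) ^ (-(((d : ℝ) - 2) / 2)))
      ((√(1 + 2 * t))⁻¹ ^ d) t := by
    intro t ht
    have ht : (0 : ℝ) ≤ t := ht
    have hpos : 0 < 1 + 2 * t := by linarith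
    have hexp : -(((d : ℝ) - 2) / 2) - 1 = -(1 / 2) * d := by ring
    refine (((((hasDerivAt_id' t).const_mul 2).const_add 1).rpow_const
      (p := -(((d : ℝ) - 2) / 2)) (Or.inl hpos.ne')).const_mul (-((d : ℝ) - 2)⁻¹)).congr_deriv ?_
    rw [hexp, Real.rpow_mul hpos.le, Real.rpow_natCast, Real.rpow_neg hpos.le,
      ← Real.sqrt_eq_rpow]
    field_simp [(sub_pos.2 hd').ne']
  have nonneg : ∀ t ∈ Set.Ioi (0 : ℝ), 0 ≤ (√(1 + 2 * t))⁻¹ ^ d := fun t _ => by positivity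
  rw [← ofReal_integral_eq_lintegral_ofReal
    (integrableOn_Ioi_deriv_of_nonneg' hasDerivAt_primitive nonneg tendsto_primitive)
    ((ae_restrict_mem measurableSet_Ioi).mono nonneg),
    integral_Ioi_of_hasDerivAt_of_nonneg' hasDerivAt_primitive nonneg tendsto_primitive]
  simp

lemma lintegral_inv_norm_sq_stdGaussian (hE : 2 < Module.finrank ℝ E) :
    ∫⁻ x, (ENNReal.ofReal (‖x‖ ^ 2))⁻¹ ∂stdGaussian E
      = ENNReal.ofReal ((Module.finrank ℝ E : ℝ) - 2)⁻¹ := by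
  simp only [← lintegral_exp_neg_mul (sq_nonneg _)]
  rw [lintegral_lintegral_swap (by fun_prop), ← lintegral_inv_sqrt_one_add_pow hE]
  refine setLIntegral_congr_fun measurableSet_Ioi fun t ht => ?_
  have ht : (0 : ℝ) < t := ht
  have integrable_exp : Integrable (fun x : E => Real.exp (-t * ‖x‖ ^ 2)) (stdGaussian E) := by
    refine (integrable_const (1 : ℝ)).mono' (by fun_prop) (ae_of_all _ fun x => ?_)
    rw [Real.norm_eq_abs, Real.abs_exp, Real.exp_le_one_iff, neg_mul, neg_nonpos]
    positivity
  rw [← integral_exp_neg_mul_norm_sq_stdGaussian ht.le,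
    ofReal_integral_eq_lintegral_ofReal integrable_exp (ae_of_all _ fun x => (Real.exp_pos _).le)]

lemma integral_norm_sq_stdGaussian : ∫ x, ‖x‖ ^ 2 ∂stdGaussian E = Module.finrank ℝ E := by
  have integral_inner_sq (k : Fin (Module.finrank ℝ E)) :
      ∫ x, (inner ℝ (stdOrthonormalBasis ℝ E k) x) ^ 2 ∂stdGaussian E = 1 := by
    have h := variance_dual_stdGaussian (innerSL ℝ (stdOrthonormalBasis ℝ E k))
    rw [variance_of_integral_eq_zero (by fun_prop) (integral_strongDual_stdGaussian _)] at h
    simpa using h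
  have memLp_inner (k : Fin (Module.finrank ℝ E)) :
      MemLp (fun x => inner ℝ (stdOrthonormalBasis ℝ E k) x) 2 (stdGaussian E) :=
    IsGaussian.memLp_dual _ (innerSL ℝ (stdOrthonormalBasis ℝ E k)) 2 (by simp)
  simp only [← (stdOrthonormalBasis ℝ E).sum_sq_inner_right]
  rw [integral_finsetSum _ fun k _ => (memLp_inner k).integrable_sq]
  simp [integral_inner_sq]

lemma stdGaussian_singleton_zero [Nontrivial E] : stdGaussian E {0} = 0 := by
  obtain ⟨u, hu⟩ := exists_ne (0 : E)
  have map_inner : (stdGaussian E).map (innerSL ℝ u) = gaussianReal 0 (‖u‖ ^ 2).toNNReal := by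
    rw [IsGaussian.map_eq_gaussianReal, integral_strongDual_stdGaussian, variance_dual_stdGaussian,
      innerSL_apply_norm]
  have : NullSingletonClass (gaussianReal 0 (‖u‖ ^ 2).toNNReal) :=
    nullSingletonClass_gaussianReal (by simpa using hu)
  refine measure_mono_null (t := innerSL ℝ u ⁻¹' {0}) (by simp) ?_
  rw [← Measure.map_apply (by fun_prop) (measurableSet_singleton 0), map_inner,
    measure_singleton]

end StdGaussian

section ComplexGaussian

variable (E : Type*) {F : Type*} [NormedAddCommGroup E] [InnerProductSpace ℂ E]
  [FiniteDimensional ℂ E] [MeasurableSpace E] [NormedAddCommGroup F]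
  [InnerProductSpace ℂ F] [FiniteDimensional ℂ F] [MeasurableSpace F]

attribute [local instance] InnerProductSpace.complexToReal

/-- The isotropic (circularly symmetric) complex Gaussian law `CN(0, v I)` on a finite-dimensional
complex inner product space: in an orthonormal basis, the coordinates are independent and each of
them has variance `v`, shared equally by its real and imaginary parts. -/
noncomputable def complexGaussian (v : ℝ) : Measure E :=
  (stdGaussian E).map fun x => √(v / 2) • x

variable {E} [BorelSpace E] [BorelSpace F] {v : ℝ}

instance : IsProbabilityMeasure (complexGaussian E v) :=
  Measure.isProbabilityMeasure_map (by fun_prop)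

lemma charFun_complexGaussian (hv : 0 ≤ v) (t : E) :
    charFun (complexGaussian E v) t = Complex.exp (-(v * ‖t‖ ^ 2 / 4 : ℝ)) := by
  rw [complexGaussian, charFun_map_smul, charFun_stdGaussian, norm_smul, Real.norm_eq_abs]
  have : (|√(v / 2)| * ‖t‖) ^ 2 = v / 2 * ‖t‖ ^ 2 := by
    rw [mul_pow, sq_abs, Real.sq_sqrt (by positivity)]
  rw [← Complex.ofReal_pow, this]
  push_cast
  ring_nf

lemma stdComplexGaussian_eq_complexGaussian : stdComplexGaussian = complexGaussian ℂ 1 := by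
  have hmeas : Measurable (fun p : ℝ × ℝ => (⟨p.1, p.2⟩ : ℂ)) :=
    Complex.measurableEquivRealProd.symm.measurable
  have : IsProbabilityMeasure stdComplexGaussian :=
    Measure.isProbabilityMeasure_map hmeas.aemeasurable
  refine Measure.ext_of_charFun (funext fun t => ?_)
  have exp_inner_eq_mul (p : ℝ × ℝ) : Complex.exp (inner ℝ (⟨p.1, p.2⟩ : ℂ) t * Complex.I)
      = Complex.exp (t.re * p.1 * Complex.I) * Complex.exp (t.im * p.2 * Complex.I) := by
    rw [← Complex.exp_add, Complex.inner]
    congr 1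
    simp
    ring
  rw [charFun_complexGaussian zero_le_one, charFun_apply, stdComplexGaussian,
    integral_map hmeas.aemeasurable (by fun_prop)]
  simp only [exp_inner_eq_mul]
  rw [integral_prod_mul (fun x : ℝ => Complex.exp (t.re * x * Complex.I))
      (fun y : ℝ => Complex.exp (t.im * y * Complex.I)),
    ← charFun_apply_real, ← charFun_apply_real, charFun_gaussianReal, charFun_gaussianReal,
    ← Complex.exp_add, Complex.sq_norm, Complex.normSq_apply]
  push_cast
  ring_nf

lemma complexGaussian_map (L : E →ₗ[ℂ] F) {c : ℝ} (hc : 0 ≤ c) (hv : 0 ≤ v)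
    (hL : ∀ t, ‖L.adjoint t‖ ^ 2 = c * ‖t‖ ^ 2) :
    (complexGaussian E v).map L = complexGaussian F (c * v) := by
  have hmeas : Measurable L := L.continuous_of_finiteDimensional.measurable
  have : IsProbabilityMeasure ((complexGaussian E v).map L) :=
    Measure.isProbabilityMeasure_map hmeas.aemeasurable
  refine Measure.ext_of_charFun (funext fun t => ?_)
  have inner_map (x : E) : (inner ℝ (L x) t : ℝ) = inner ℝ x (L.adjoint t) :=
    congrArg Complex.re (L.adjoint_inner_right x t).symm
  rw [charFun_complexGaussian (mul_nonneg hc hv), mul_comm c, mul_assoc, ← hL,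
    ← charFun_complexGaussian hv, charFun_apply, charFun_apply,
    integral_map hmeas.aemeasurable (by fun_prop)]
  simp only [inner_map]

lemma measurePreserving_complexGaussian_inner (hv : 0 ≤ v) (u : E) :
    MeasurePreserving (fun x => inner ℂ u x) (complexGaussian E v)
      (complexGaussian ℂ (‖u‖ ^ 2 * v)) := by
  refine ⟨by fun_prop, complexGaussian_map (innerₛₗ ℂ u) (by positivity) hv fun z => ?_⟩
  have : (innerₛₗ ℂ u).adjoint z = z • u := ext_inner_right ℂ fun y => by
    simp [LinearMap.adjoint_inner_left, inner_smul_left, mul_comm]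
  rw [this, norm_smul]
  ring

lemma measurePreserving_complexGaussian_smul (hv : 0 ≤ v) (z : ℂ) :
    MeasurePreserving (fun x => z • x) (complexGaussian E v)
      (complexGaussian E (‖z‖ ^ 2 * v)) := by
  refine ⟨by fun_prop, complexGaussian_map (z • (LinearMap.id : E →ₗ[ℂ] E)) (by positivity) hv
    fun t => ?_⟩
  have : (z • (LinearMap.id : E →ₗ[ℂ] E)).adjoint t = star z • t := ext_inner_right ℂ fun y => by
    simp [LinearMap.adjoint_inner_left, inner_smul_left, inner_smul_right]
  rw [this, norm_smul, norm_star, mul_pow]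

lemma measurePreserving_complexGaussian_neg (hv : 0 ≤ v) :
    MeasurePreserving (fun x => -x) (complexGaussian E v) (complexGaussian E v) := by
  simpa using measurePreserving_complexGaussian_smul (E := E) hv (-1)

lemma measurePreserving_complexGaussian_orthogonalProjectionOnto (hv : 0 ≤ v) (V : Submodule ℂ E) :
    MeasurePreserving V.orthogonalProjectionOnto (complexGaussian E v) (complexGaussian V v) := by
  refine ⟨by fun_prop, ?_⟩
  have h := complexGaussian_map (V.orthogonalProjectionOnto : E →ₗ[ℂ] V) zero_le_one hv fun t => ?_
  · simpa using h
  have : (V.orthogonalProjectionOnto : E →ₗ[ℂ] V).adjoint t = t := ext_inner_right ℂ fun y => by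
    simp [LinearMap.adjoint_inner_left]
  rw [this, one_mul, Submodule.coe_norm]

lemma hasLaw_sum_smul_orthonormalBasis {ι Ω : Type*} [Fintype ι] [MeasurableSpace Ω]
    {μ : Measure Ω} [IsProbabilityMeasure μ] (b : OrthonormalBasis ι ℂ E) (hv : 0 ≤ v)
    {z : ι → Ω → ℂ}
    (hz : ∀ k, HasLaw (z k) (complexGaussian ℂ v) μ) (hindep : iIndepFun z μ) :
    HasLaw (fun ω => ∑ k, z k ω • b k) (complexGaussian E v) μ := by
  have hmeas (k : ι) : AEMeasurable (fun ω => z k ω • b k) μ := (hz k).aemeasurable.smul_const _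
  have : IsProbabilityMeasure (μ.map fun ω => ∑ k, z k ω • b k) :=
    Measure.isProbabilityMeasure_map (Finset.aemeasurable_fun_sum _ fun k _ => hmeas k)
  refine ⟨Finset.aemeasurable_fun_sum _ fun k _ => hmeas k,
    Measure.ext_of_charFun (funext fun t => ?_)⟩
  have inner_smul_eq (k : ι) (w : ℂ) :
      (inner ℝ (w • b k) t : ℝ) = inner ℝ w (inner ℂ (b k) t : ℂ) := by
    change (inner ℂ (w • b k) t : ℂ).re = (inner ℂ w (inner ℂ (b k) t : ℂ) : ℂ).re
    simp [mul_comm]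
  have charFun_term (k : ι) : charFun (μ.map fun ω => z k ω • b k) t
      = Complex.exp (-(v * ‖inner ℂ (b k) t‖ ^ 2 / 4 : ℝ)) := by
    rw [← charFun_complexGaussian hv, ← (hz k).map_eq, charFun_apply, charFun_apply,
      integral_map (hmeas k) (by fun_prop), integral_map (hz k).aemeasurable (by fun_prop)]
    simp only [inner_smul_eq]
  rw [(hindep.comp (fun k w => w • b k) (by fun_prop)).charFun_map_fun_sum_eq_prod hmeas,
    Finset.prod_apply, Finset.prod_congr rfl fun k _ => charFun_term k, ← Complex.exp_sum,
    charFun_complexGaussian hv, ← b.sum_sq_norm_inner_right t]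
  push_cast
  simp only [Finset.sum_neg_distrib, Finset.mul_sum, Finset.sum_div]

lemma integrable_norm_sq_complexGaussian :
    Integrable (fun x => ‖x‖ ^ 2) (complexGaussian E v) := by
  rw [complexGaussian, integrable_map_measure (by fun_prop) (by fun_prop)]
  simp only [Function.comp_def, norm_smul, mul_pow]
  exact (IsGaussian.memLp_two_id.norm.integrable_sq).const_mul _

lemma integral_norm_sq_complexGaussian (hv : 0 ≤ v) :
    ∫ x, ‖x‖ ^ 2 ∂complexGaussian E v = v * Module.finrank ℂ E := by
  rw [complexGaussian, integral_map (by fun_prop) (by fun_prop)]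
  simp only [norm_smul, mul_pow, Real.norm_eq_abs, sq_abs, Real.sq_sqrt (div_nonneg hv zero_le_two)]
  rw [integral_const_mul, integral_norm_sq_stdGaussian, finrank_real_of_complex]
  push_cast
  ring

lemma integral_norm_inner_sq_complexGaussian (hv : 0 ≤ v) (u : E) :
    ∫ x, ‖inner ℂ u x‖ ^ 2 ∂complexGaussian E v = v * ‖u‖ ^ 2 := by
  have hinner := measurePreserving_complexGaussian_inner hv u
  have h := integral_norm_sq_complexGaussian (E := ℂ) (mul_nonneg (sq_nonneg ‖u‖) hv)
  rw [← hinner.map_eq, integral_map hinner.measurable.aemeasurable (by fun_prop)] at h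
  simpa [mul_comm] using h

lemma lintegral_inv_norm_sq_complexGaussian (hv : 0 < v) (hE : 1 < Module.finrank ℂ E) :
    ∫⁻ x, (ENNReal.ofReal (‖x‖ ^ 2))⁻¹ ∂complexGaussian E v
      = ENNReal.ofReal (v * (Module.finrank ℂ E - 1))⁻¹ := by
  have hv2 : 0 < v / 2 := half_pos hv
  have hE' : 2 < Module.finrank ℝ E := by rw [finrank_real_of_complex]; omega
  have norm_sq_smul (x : E) : (ENNReal.ofReal (‖√(v / 2) • x‖ ^ 2))⁻¹
      = ENNReal.ofReal (v / 2)⁻¹ * (ENNReal.ofReal (‖x‖ ^ 2))⁻¹ := by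
    rw [norm_smul, mul_pow, Real.norm_eq_abs, sq_abs, Real.sq_sqrt hv2.le,
      ENNReal.ofReal_mul hv2.le, ENNReal.mul_inv (by simp [hv2]) (by simp),
      ENNReal.ofReal_inv_of_pos hv2]
  rw [complexGaussian, lintegral_map (by fun_prop) (by fun_prop)]
  simp only [norm_sq_smul]
  rw [lintegral_const_mul _ (by fun_prop), lintegral_inv_norm_sq_stdGaussian hE',
    ← ENNReal.ofReal_mul (inv_nonneg.2 hv2.le), ← mul_inv, finrank_real_of_complex]
  congr 2
  push_cast
  ring

lemma complexGaussian_singleton_zero [Nontrivial E] (hv : 0 < v) :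
    complexGaussian E v {0} = 0 := by
  have preimage_zero : (fun x : E => √(v / 2) • x) ⁻¹' {0} = {0} := by
    ext x
    exact smul_eq_zero_iff_right (Real.sqrt_pos.2 (half_pos hv)).ne'
  rw [complexGaussian, Measure.map_apply (by fun_prop) (measurableSet_singleton 0),
    preimage_zero, stdGaussian_singleton_zero]

lemma ae_notMem_complexGaussian (hv : 0 < v) {V : Submodule ℂ E} (hV : V ≠ ⊤) :
    ∀ᵐ x ∂complexGaussian E v, x ∉ V := by
  have : Nontrivial Vᗮ := Submodule.nontrivial_iff_ne_bot.2 (by simpa using hV)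
  have ae_ne_zero : ∀ᵐ y ∂complexGaussian Vᗮ v, y ≠ 0 :=
    compl_mem_ae_iff.2 (complexGaussian_singleton_zero hv)
  filter_upwards [(measurePreserving_complexGaussian_orthogonalProjectionOnto hv.le
    Vᗮ).quasiMeasurePreserving.ae ae_ne_zero] with x hx hxV
  exact hx (Submodule.orthogonalProjectionOnto_orthogonal_apply_eq_zero hxV)

lemma lintegral_inv_norm_sq_orthogonalProjectionOnto_complexGaussian (hv : 0 < v)
    (V : Submodule ℂ E) (hV : 1 < Module.finrank ℂ V) :
    ∫⁻ x, (ENNReal.ofReal (‖V.orthogonalProjectionOnto x‖ ^ 2))⁻¹ ∂complexGaussian E v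
      = ENNReal.ofReal (v * (Module.finrank ℂ V - 1))⁻¹ := by
  rw [← lintegral_inv_norm_sq_complexGaussian hv hV,
    ← (measurePreserving_complexGaussian_orthogonalProjectionOnto hv.le V).lintegral_comp
      (by fun_prop)]

end ComplexGaussian

section DualFamily

variable (𝕜 : Type*) {E ι : Type*} [RCLike 𝕜] [NormedAddCommGroup E] [InnerProductSpace 𝕜 E]
  [Fintype ι] [DecidableEq ι]

/-- The dual (biorthogonal) family of a finite family `v` inside its own span, obtained from the
inverse Gram matrix. In coordinates its members are the columns of `V (Vᴴ V)⁻¹`, where `V` is the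
matrix with columns `v`. It is meaningful only when `v` is linearly independent. -/
noncomputable def dualFamily (v : ι → E) (i : ι) : E :=
  ∑ k, (Matrix.gram 𝕜 v)⁻¹ k i • v k

variable {𝕜} {v : ι → E}

lemma inner_dualFamily (hv : LinearIndependent 𝕜 v) (i j : ι) :
    inner 𝕜 (dualFamily 𝕜 v i) (v j) = if i = j then 1 else 0 := by
  have isUnit_det : IsUnit (Matrix.gram 𝕜 v).det :=
    (Matrix.det_gram_ne_zero_iff_linearIndependent.2 hv).isUnit
  rw [dualFamily, sum_inner, ← Matrix.one_apply, ← Matrix.nonsing_inv_mul _ isUnit_det,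
    Matrix.mul_apply]
  refine Finset.sum_congr rfl fun k _ => ?_
  rw [inner_smul_left, ← Matrix.gram_apply (𝕜 := 𝕜) v, ← (Matrix.isHermitian_gram 𝕜 v).inv.apply,
    ← starRingEnd_apply, RCLike.conj_conj]

lemma inner_dualFamily_self (hv : LinearIndependent 𝕜 v) (i : ι) :
    inner 𝕜 (dualFamily 𝕜 v i) (v i) = 1 := by
  rw [inner_dualFamily hv, if_pos rfl]

lemma one_le_norm_dualFamily_mul_norm (hv : LinearIndependent 𝕜 v) (i : ι) :
    1 ≤ ‖dualFamily 𝕜 v i‖ * ‖v i‖ := by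
  simpa [inner_dualFamily_self hv] using norm_inner_le_norm (𝕜 := 𝕜) (dualFamily 𝕜 v i) (v i)

lemma norm_dualFamily_pos (hv : LinearIndependent 𝕜 v) (i : ι) : 0 < ‖dualFamily 𝕜 v i‖ :=
  pos_of_mul_pos_left (one_pos.trans_le (one_le_norm_dualFamily_mul_norm hv i)) (norm_nonneg _)

lemma dualFamily_mem_orthogonal (hv : LinearIndependent 𝕜 v) (i : ι) :
    dualFamily 𝕜 v i ∈ (Submodule.span 𝕜 (v '' {i}ᶜ))ᗮ := by
  rw [Submodule.mem_orthogonal]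
  intro u hu
  induction hu using Submodule.span_induction with
  | mem _ hu =>
    obtain ⟨j, hj, rfl⟩ := hu
    rw [inner_eq_zero_symm, inner_dualFamily hv, if_neg (Ne.symm hj)]
  | zero => exact inner_zero_left _
  | add _ _ _ _ hu hw => rw [inner_add_left, hu, hw, add_zero]
  | smul c _ _ hu => rw [inner_smul_left, hu, mul_zero]

lemma norm_dualFamily_sq_mul_norm_orthogonalProjectionOnto_sq (hv : LinearIndependent 𝕜 v) (i : ι)
    [(Submodule.span 𝕜 (v '' {i}ᶜ)).HasOrthogonalProjection] :
    ‖dualFamily 𝕜 v i‖ ^ 2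
      * ‖(Submodule.span 𝕜 (v '' {i}ᶜ))ᗮ.orthogonalProjectionOnto (v i)‖ ^ 2 = 1 := by
  obtain ⟨a, ha⟩ : ∃ a : (Submodule.span 𝕜 (v '' {i}ᶜ))ᗮ, (a : E) = dualFamily 𝕜 v i :=
    ⟨⟨_, dualFamily_mem_orthogonal hv i⟩, rfl⟩
  generalize hW : Submodule.span 𝕜 (v '' {i}ᶜ) = W at *
  have proj_eq_zero {j : ι} (hj : j ≠ i) : Wᗮ.orthogonalProjectionOnto (v j) = 0 :=
    Submodule.orthogonalProjectionOnto_orthogonal_apply_eq_zero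
      (hW ▸ Submodule.subset_span ⟨j, hj, rfl⟩)
  have eq_smul_proj : a = (Matrix.gram 𝕜 v)⁻¹ i i • Wᗮ.orthogonalProjectionOnto (v i) := by
    rw [← Submodule.orthogonalProjectionOnto_mem_subspace_eq_self a, ha, dualFamily, map_sum,
      Finset.sum_eq_single i (fun j _ hj => by rw [map_smul, proj_eq_zero hj, smul_zero])
        (by simp), map_smul]
  have inner_proj : inner 𝕜 a (Wᗮ.orthogonalProjectionOnto (v i)) = 1 := by
    rw [Submodule.inner_orthogonalProjectionOnto_eq_of_mem_left, ha, inner_dualFamily_self hv]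
  rw [← ha, ← Submodule.coe_norm]
  generalize Wᗮ.orthogonalProjectionOnto (v i) = p at *
  generalize (Matrix.gram 𝕜 v)⁻¹ i i = c at *
  have norm_mul_norm_sq : ‖c‖ * ‖p‖ ^ 2 = 1 := by
    simpa [eq_smul_proj, inner_smul_left, inner_self_eq_norm_sq_to_K] using
      congrArg norm inner_proj
  calc ‖a‖ ^ 2 * ‖p‖ ^ 2 = (‖c‖ * ‖p‖ ^ 2) ^ 2 := by rw [eq_smul_proj, norm_smul]; ring
    _ = 1 := by rw [norm_mul_norm_sq, one_pow]

omit [DecidableEq ι] in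
lemma finrank_orthogonal_span_image_compl [FiniteDimensional 𝕜 E] (hv : LinearIndependent 𝕜 v)
    (i : ι) :
    Module.finrank 𝕜 (Submodule.span 𝕜 (v '' {i}ᶜ))ᗮ + Fintype.card ι
      = Module.finrank 𝕜 E + 1 := by
  classical
  have card_compl : Fintype.card ({i}ᶜ : Set ι) + 1 = Fintype.card ι := by
    have := Fintype.card_pos_iff.2 ⟨i⟩
    rw [Fintype.card_compl_set, Set.card_singleton]
    omega
  have finrank_span := finrank_span_eq_card (hv.comp (Subtype.val : ({i}ᶜ : Set ι) → ι)
    Subtype.val_injective)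
  rw [Set.range_comp, Subtype.range_coe] at finrank_span
  rw [← (Submodule.span 𝕜 (v '' {i}ᶜ)).finrank_add_finrank_orthogonal, finrank_span, ← card_compl]
  ring

variable [MeasurableSpace E] [BorelSpace E] [SecondCountableTopology E]

lemma measurable_dualFamily (i : ι) : Measurable fun v : ι → E => dualFamily 𝕜 v i := by
  have continuous_gram : Continuous fun v : ι → E => Matrix.gram 𝕜 v :=
    continuous_matrix fun k l => by simp only [Matrix.gram_apply]; fun_prop
  have measurable_gram_inv (k : ι) : Measurable fun v : ι → E => (Matrix.gram 𝕜 v)⁻¹ k i := by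
    simp only [Matrix.inv_def, Ring.inverse_eq_inv, Matrix.smul_apply, smul_eq_mul]
    exact (continuous_gram.matrix_det.measurable.inv).mul
      (continuous_gram.matrix_adjugate.matrix_elem k i).measurable
  exact Finset.measurable_fun_sum _ fun k _ => (measurable_gram_inv k).smul (measurable_pi_apply k)

end DualFamily

lemma measurePreserving_update_pi {ι : Type*} [Fintype ι] [DecidableEq ι] {α : ι → Type*}
    [∀ i, MeasurableSpace (α i)] (ν : ∀ i, Measure (α i)) [∀ i, IsProbabilityMeasure (ν i)]
    (i : ι) :
    MeasurePreserving (fun p : (∀ j, α j) × α i => Function.update p.1 i p.2)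
      ((Measure.pi ν).prod (ν i)) (Measure.pi ν) := by
  have hmeas : Measurable fun p : (∀ j, α j) × α i => Function.update p.1 i p.2 :=
    measurable_update'
  refine ⟨hmeas, (Measure.pi_eq fun s hs => ?_).symm⟩
  have preimage_box : (fun p : (∀ j, α j) × α i => Function.update p.1 i p.2) ⁻¹' Set.univ.pi s
      = Set.univ.pi (Function.update s i Set.univ) ×ˢ s i := by
    ext p
    simp only [Set.mem_preimage, Set.mem_univ_pi, Set.mem_prod,
      Function.forall_update_iff p.1 fun j x => x ∈ s j,
      Function.forall_update_iff s fun j t => p.1 j ∈ t, Set.mem_univ, true_and, and_comm]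
  rw [Measure.map_apply hmeas (MeasurableSet.univ_pi hs), preimage_box, Measure.prod_prod,
    Measure.pi_pi, ← Finset.prod_erase_mul _ _ (Finset.mem_univ i),
    ← Finset.prod_erase_mul (f := fun j => ν j (s j)) _ (Finset.mem_univ i), Function.update_self,
    measure_univ, mul_one]
  congr 1
  exact Finset.prod_congr rfl fun j hj => by rw [Function.update_of_ne (Finset.ne_of_mem_erase hj)]

section GaussianFamily

variable (E : Type*) {ι : Type*} [NormedAddCommGroup E] [InnerProductSpace ℂ E]
  [FiniteDimensional ℂ E] [MeasurableSpace E] [Fintype ι]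

/-- The law of a family of independent isotropic complex Gaussian vectors, where `β i` is the
variance of the `i`-th vector: the law of the channels of all users. -/
noncomputable abbrev gaussianFamily (β : ι → ℝ) : Measure (ι → E) :=
  Measure.pi fun i => complexGaussian E (β i)

variable {E} [BorelSpace E] {β : ι → ℝ}

lemma measurePreserving_update_gaussianFamily [DecidableEq ι] (i : ι) :
    MeasurePreserving (fun p : (ι → E) × E => Function.update p.1 i p.2)
      ((gaussianFamily E β).prod (complexGaussian E (β i))) (gaussianFamily E β) :=
  measurePreserving_update_pi _ i

lemma ae_linearIndepOn_gaussianFamily (hβ : ∀ i, 0 < β i) {s : Finset ι}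
    (hs : s.card ≤ Module.finrank ℂ E) :
    ∀ᵐ v ∂gaussianFamily E β, LinearIndepOn ℂ v (s : Set ι) := by
  classical
  induction s using Finset.induction_on with
  | empty => exact ae_of_all _ fun v => by simp
  | insert i s hi ih =>
    rw [Finset.card_insert_of_notMem hi] at hs
    have measurableSet_linearIndepOn :
        MeasurableSet {v : ι → E | LinearIndepOn ℂ v (insert i s : Finset ι)} :=
      (isOpen_setOfPred_linearIndependent.preimage (f := fun (v : ι → E) (j : (insert i s :
        Finset ι)) => v j) (by fun_prop)).measurableSet
    have resample := measurePreserving_update_gaussianFamily (E := E) (β := β) i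
    rw [← resample.map_eq, ae_map_iff resample.measurable.aemeasurable measurableSet_linearIndepOn]
    refine (Measure.ae_prod_iff_ae_ae (resample.measurable measurableSet_linearIndepOn)).2 ?_
    filter_upwards [ih (by omega)] with v hv
    have update_eqOn (x : E) : Set.EqOn (Function.update v i x) v s := fun j hj =>
      Function.update_of_ne (fun h => hi (by simpa [← h] using hj)) _ _
    have span_ne_top : Submodule.span ℂ (v '' s) ≠ ⊤ := fun h => by
      have := finrank_span_finset_le_card (R := ℂ) (s.image v)
      rw [Finset.coe_image, Set.finrank, h, finrank_top] at this
      have := this.trans Finset.card_image_le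
      omega
    filter_upwards [ae_notMem_complexGaussian (hβ i) span_ne_top] with x hx
    rw [Finset.coe_insert, linearIndepOn_insert (by simpa using hi),
      (update_eqOn x).image_eq, Function.update_self]
    exact ⟨hv.congr (update_eqOn x).symm, hx⟩

lemma ae_linearIndependent_gaussianFamily (hβ : ∀ i, 0 < β i)
    (hι : Fintype.card ι ≤ Module.finrank ℂ E) :
    ∀ᵐ v ∂gaussianFamily E β, LinearIndependent ℂ v := by
  simpa using ae_linearIndepOn_gaussianFamily hβ (s := Finset.univ) hι

/-- Given the other vectors, `‖dualFamily ℂ v i‖⁻¹` is the length of the projection of `v i` onto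
the orthogonal complement of their span, which has dimension `finrank ℂ E - card ι + 1`. -/
lemma lintegral_norm_dualFamily_sq [DecidableEq ι] (hβ : ∀ i, 0 < β i)
    (hι : Fintype.card ι < Module.finrank ℂ E) (i : ι) :
    ∫⁻ v, ENNReal.ofReal (‖dualFamily ℂ v i‖ ^ 2) ∂gaussianFamily E β
      = ENNReal.ofReal (β i * (Module.finrank ℂ E - Fintype.card ι))⁻¹ := by
  have resample := measurePreserving_update_gaussianFamily (E := E) (β := β) i
  have hmeas : Measurable fun v : ι → E => ENNReal.ofReal (‖dualFamily ℂ v i‖ ^ 2) :=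
    ((measurable_dualFamily i).norm.pow_const 2).ennreal_ofReal
  have ae_linearIndependent_update := Measure.ae_ae_of_ae_prod
    (resample.quasiMeasurePreserving.ae (ae_linearIndependent_gaussianFamily hβ hι.le))
  rw [← resample.lintegral_comp hmeas,
    lintegral_prod _ (by exact (hmeas.comp resample.measurable).aemeasurable)]
  suffices h : ∀ᵐ v ∂gaussianFamily E β, ∫⁻ x, ENNReal.ofReal
      (‖dualFamily ℂ (Function.update v i x) i‖ ^ 2) ∂complexGaussian E (β i)
        = ENNReal.ofReal (β i * (Module.finrank ℂ E - Fintype.card ι))⁻¹ by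
    rw [lintegral_congr_ae h, lintegral_const, measure_univ, mul_one]
  filter_upwards [ae_linearIndependent_update] with v hv
  have image_update (x : E) : Function.update v i x '' {i}ᶜ = v '' {i}ᶜ :=
    Set.EqOn.image_eq fun j hj => Function.update_of_ne hj _ _
  have norm_dualFamily_update : ∀ᵐ x ∂complexGaussian E (β i),
      ENNReal.ofReal (‖dualFamily ℂ (Function.update v i x) i‖ ^ 2) = (ENNReal.ofReal
        (‖(Submodule.span ℂ (v '' {i}ᶜ))ᗮ.orthogonalProjectionOnto x‖ ^ 2))⁻¹ := by
    filter_upwards [hv] with x hx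
    have h := norm_dualFamily_sq_mul_norm_orthogonalProjectionOnto_sq hx i
    rw [image_update, Function.update_self] at h
    refine ENNReal.eq_inv_of_mul_eq_one_left ?_
    rw [← ENNReal.ofReal_mul (sq_nonneg _), h, ENNReal.ofReal_one]
  obtain ⟨x, hx⟩ := hv.exists
  have finrank_orthogonal := finrank_orthogonal_span_image_compl hx i
  rw [image_update] at finrank_orthogonal
  rw [lintegral_congr_ae norm_dualFamily_update,
    lintegral_inv_norm_sq_orthogonalProjectionOnto_complexGaussian (hβ i) _ (by omega)]
  rify at finrank_orthogonal
  congr 3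
  linarith

end GaussianFamily

lemma norm_sq_sum_eq_sum_sum_inner {ι F : Type*} [NormedAddCommGroup F] [InnerProductSpace ℝ F]
    (s : Finset ι) (a : ι → F) :
    ‖∑ j ∈ s, a j‖ ^ 2 = ∑ j ∈ s, ∑ k ∈ s, inner ℝ (a j) (a k) := by
  rw [← real_inner_self_eq_norm_sq, sum_inner]
  exact Finset.sum_congr rfl fun j _ => inner_sum _ _ _

lemma integral_norm_sq_sum_of_uncorrelated {Ω ι F : Type*} [MeasurableSpace Ω] {μ : Measure Ω}
    [NormedAddCommGroup F] [InnerProductSpace ℝ F] {s : Finset ι} {X : ι → Ω → F}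
    (hint : ∀ j k, Integrable (fun ω => inner ℝ (X j ω) (X k ω)) μ)
    (horth : ∀ j k, j ≠ k → ∫ ω, inner ℝ (X j ω) (X k ω) ∂μ = 0) :
    ∫ ω, ‖∑ j ∈ s, X j ω‖ ^ 2 ∂μ = ∑ j ∈ s, ∫ ω, ‖X j ω‖ ^ 2 ∂μ := by
  simp only [norm_sq_sum_eq_sum_sum_inner]
  rw [integral_finsetSum _ fun j _ => integrable_finsetSum _ fun k _ => hint j k]
  refine Finset.sum_congr rfl fun j hj => ?_
  rw [integral_finsetSum _ fun k _ => hint j k,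
    Finset.sum_eq_single_of_mem j hj fun k _ hkj => horth j k hkj.symm]
  simp only [real_inner_self_eq_norm_sq]

section MaxRatioPrecoding

variable {E ι : Type*} [NormedAddCommGroup E] [InnerProductSpace ℂ E]

/-- The gain seen by the user with channel `v i` on the unit beam pointing at `v j`, which is the
maximum ratio beam of user `j`. -/
noncomputable def beamGain (v : ι → E) (i j : ι) : ℂ := inner ℂ (v i) (NormedSpace.normalize (v j))

lemma norm_beamGain_self (v : ι → E) (i : ι) : ‖beamGain v i i‖ = ‖v i‖ := by
  rcases eq_or_ne (v i) 0 with hv | hv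
  · simp [beamGain, hv]
  · have := norm_ne_zero_iff.2 hv
    rw [beamGain, NormedSpace.normalize, ← Complex.coe_smul, inner_smul_right,
      inner_self_eq_norm_sq_to_K]
    simp [sq, this]

lemma norm_beamGain_le (v : ι → E) (i j : ι) : ‖beamGain v i j‖ ≤ ‖v i‖ := by
  refine (norm_inner_le_norm _ _).trans (mul_le_of_le_one_right (norm_nonneg _) ?_)
  rcases eq_or_ne (v j) 0 with hv | hv
  · simp [hv]
  · exact (NormedSpace.norm_normalize hv).le

variable [FiniteDimensional ℂ E] [MeasurableSpace E] [BorelSpace E]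

lemma measurable_beamGain (i j : ι) : Measurable fun v : ι → E => beamGain v i j := by
  unfold beamGain NormedSpace.normalize
  fun_prop

variable [Fintype ι] {β : ι → ℝ}

lemma integrable_inner_beamGain (i j k : ι) :
    Integrable (fun v : ι → E => inner ℝ (beamGain v i j) (beamGain v i k))
      (gaussianFamily E β) := by
  refine Integrable.mono'
    (integrable_comp_eval (μ := fun i => complexGaussian E (β i)) (i := i)
      integrable_norm_sq_complexGaussian)
    ((measurable_beamGain i j).inner (measurable_beamGain i k)).aestronglyMeasurable
    (ae_of_all _ fun v => (norm_inner_le_norm _ _).trans ?_)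
  rw [sq]
  exact mul_le_mul (norm_beamGain_le v i j) (norm_beamGain_le v i k) (norm_nonneg _) (norm_nonneg _)

lemma integrable_norm_sum_smul_beamGain_sq (c : ι → ℝ) (i : ι) :
    Integrable (fun v : ι → E => ‖∑ j, c j • beamGain v i j‖ ^ 2) (gaussianFamily E β) := by
  simp only [norm_sq_sum_eq_sum_sum_inner, real_inner_smul_left, real_inner_smul_right]
  exact integrable_finsetSum _ fun j _ => integrable_finsetSum _ fun k _ =>
    ((integrable_inner_beamGain i j k).const_mul _).const_mul _

lemma integral_norm_beamGain_self_sq (hβ : ∀ i, 0 ≤ β i) (i : ι) :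
    ∫ v, ‖beamGain v i i‖ ^ 2 ∂gaussianFamily E β = β i * Module.finrank ℂ E := by
  simp only [norm_beamGain_self]
  rw [integral_comp_eval (μ := fun i => complexGaussian E (β i)) (f := fun x : E => ‖x‖ ^ 2)
    (by fun_prop), integral_norm_sq_complexGaussian (hβ i)]

lemma measurePreserving_update_neg [DecidableEq ι] (hβ : ∀ i, 0 ≤ β i) (l : ι) :
    MeasurePreserving (fun v : ι → E => Function.update v l (-v l))
      (gaussianFamily E β) (gaussianFamily E β) := by
  have h : ∀ m, MeasurePreserving (fun x : E => if m = l then -x else x) (complexGaussian E (β m))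
      (complexGaussian E (β m)) := fun m => by
    split_ifs with hm
    · exact measurePreserving_complexGaussian_neg (hβ m)
    · exact MeasurePreserving.id _
  convert measurePreserving_pi _ _ h with v m
  rw [Function.update_apply]
  split_ifs with hm
  · rw [hm]
  · rfl

lemma integral_inner_beamGain_of_ne (hβ : ∀ i, 0 ≤ β i) (i : ι) {j k : ι} (hjk : j ≠ k) :
    ∫ v, inner ℝ (beamGain v i j) (beamGain v i k) ∂gaussianFamily E β = 0 := by
  classical
  wlog hki : k ≠ i generalizing j k
  · rw [not_not] at hki
    simpa only [real_inner_comm] using this hjk.symm (hki ▸ hjk)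
  have flip := measurePreserving_update_neg (E := E) hβ k
  have h := integral_map (μ := gaussianFamily E β) flip.measurable.aemeasurable
    ((measurable_beamGain i j).inner (𝕜 := ℝ) (measurable_beamGain i k)).aestronglyMeasurable
  simp only [flip.map_eq, beamGain, Function.update_self, Function.update_of_ne hki.symm,
    Function.update_of_ne hjk, NormedSpace.normalize_neg, inner_neg_right, integral_neg] at h
  exact self_eq_neg.1 h

lemma integral_norm_beamGain_sq_of_ne [Nontrivial E] (hβ : ∀ i, 0 < β i) {i j : ι} (hji : j ≠ i) :
    ∫ v, ‖beamGain v i j‖ ^ 2 ∂gaussianFamily E β = β i := by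
  classical
  have resample := measurePreserving_update_gaussianFamily (E := E) (β := β) i
  have hint := integrable_inner_beamGain (E := E) (β := β) i j j
  simp only [real_inner_self_eq_norm_sq] at hint
  rw [← resample.map_eq] at hint ⊢
  rw [integral_map resample.measurable.aemeasurable hint.aestronglyMeasurable,
    integral_prod _ (by exact hint.comp_measurable resample.measurable)]
  simp only [beamGain, Function.update_self, Function.update_of_ne hji,
    norm_inner_symm _ (NormedSpace.normalize _), integral_norm_inner_sq_complexGaussian (hβ i).le]
  have norm_normalize : ∀ᵐ v ∂gaussianFamily E β,
      β i * ‖NormedSpace.normalize (v j)‖ ^ 2 = β i := by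
    filter_upwards [(measurePreserving_eval (fun i => complexGaussian E (β i))
      j).quasiMeasurePreserving.ae (compl_mem_ae_iff.2 (complexGaussian_singleton_zero (hβ j)))]
      with v hv
    rw [NormedSpace.norm_normalize hv, one_pow, mul_one]
  rw [integral_congr_ae norm_normalize, integral_const, probReal_univ, one_smul]

lemma integral_norm_sum_smul_beamGain_sq [Nontrivial E] [DecidableEq ι] (hβ : ∀ i, 0 < β i)
    (c : ι → ℝ) (i : ι) :
    ∫ v, ‖∑ j, c j • beamGain v i j‖ ^ 2 ∂gaussianFamily E β
      = β i * (c i ^ 2 * Module.finrank ℂ E + ∑ j ∈ Finset.univ.erase i, c j ^ 2) := by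
  have inner_smul_smul (v : ι → E) (j k : ι) : inner ℝ (c j • beamGain v i j) (c k • beamGain v i k)
      = c j * c k * inner ℝ (beamGain v i j) (beamGain v i k) := by
    rw [real_inner_smul_left, real_inner_smul_right, mul_assoc]
  rw [integral_norm_sq_sum_of_uncorrelated]
  · simp only [norm_smul, mul_pow, Real.norm_eq_abs, sq_abs, integral_const_mul]
    rw [← Finset.add_sum_erase _ _ (Finset.mem_univ i),
      integral_norm_beamGain_self_sq (fun j => (hβ j).le), mul_add, Finset.mul_sum]
    refine congrArg₂ _ (by ring) (Finset.sum_congr rfl fun j hj => ?_)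
    rw [integral_norm_beamGain_sq_of_ne hβ (Finset.ne_of_mem_erase hj), mul_comm]
  · exact fun j k => by
      simpa only [inner_smul_smul] using (integrable_inner_beamGain i j k).const_mul _
  · intro j k hjk
    simp only [inner_smul_smul, integral_const_mul]
    rw [integral_inner_beamGain_of_ne (fun j => (hβ j).le) i hjk, mul_zero]

end MaxRatioPrecoding

section Channel

lemma iIndepFun_curry {ι κ Ω 𝓧 : Type*} [Finite ι] [Finite κ] [MeasurableSpace Ω]
    [MeasurableSpace 𝓧] {μ : Measure Ω} {X : ι → κ → Ω → 𝓧} (hX : ∀ i j, AEMeasurable (X i j) μ)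
    (hindep : iIndepFun (fun q : ι × κ => X q.1 q.2) μ) :
    iIndepFun (fun i ω j => X i j ω) μ := by
  cases nonempty_fintype ι
  cases nonempty_fintype κ
  have := hindep.isProbabilityMeasure
  have hprob (i : ι) (j : κ) : IsProbabilityMeasure (μ.map (X i j)) :=
    Measure.isProbabilityMeasure_map (hX i j)
  have hlaw (i : ι) (j : κ) : HasLaw (X i j) (μ.map (X i j)) μ := ⟨hX i j, rfl⟩
  have hrow (i : ι) : HasLaw (fun ω j => X i j ω) (Measure.pi fun j => μ.map (X i j)) μ :=
    (hindep.precomp (Prod.mk_right_injective i)).hasLaw_pi (hlaw i)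
  have hcurry := Measure.infinitePi_map_curry fun i j => μ.map (X i j)
  simp only [Measure.infinitePi_eq_pi] at hcurry
  exact (iIndepFun_iff_hasLaw_pi_pi hrow).2
    (MeasurePreserving.comp_hasLaw ⟨MeasurableEquiv.measurable _, hcurry⟩
      (hindep.hasLaw_pi fun q => hlaw q.1 q.2))

variable {M K : ℕ} {Ω : Type*}

lemma chan_eq_smul_sum (P : Params K) (h : Fin K → Fin M → Ω → ℂ) (i : Fin K) (ω : Ω) :
    chan P h i ω
      = (√(P.β i) : ℂ) • ∑ j, h i j ω • EuclideanSpace.basisFun (Fin M) ℂ j := by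
  ext k
  simp [chan, Pi.single_apply]

variable [MeasurableSpace Ω] {μ : Measure Ω} {P : Params K} {h : Fin K → Fin M → Ω → ℂ}

lemma hasLaw_chan (hβ : ∀ i, 0 ≤ P.β i) (hlaw : ∀ i j, HasLaw (h i j) stdComplexGaussian μ)
    (hindep : iIndepFun (fun q : Fin K × Fin M => h q.1 q.2) μ) :
    HasLaw (fun ω i => chan P h i ω) (gaussianFamily (EuclideanSpace ℂ (Fin M)) P.β) μ := by
  have := hindep.isProbabilityMeasure
  simp only [stdComplexGaussian_eq_complexGaussian] at hlaw
  simp only [chan_eq_smul_sum]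
  have hcoord (i : Fin K) : iIndepFun (h i) μ :=
    hindep.precomp (g := Prod.mk i) (Prod.mk_right_injective i)
  have hrow (i : Fin K) := hasLaw_sum_smul_orthonormalBasis (EuclideanSpace.basisFun (Fin M) ℂ)
    zero_le_one (hlaw i) (hcoord i)
  have hchan (i : Fin K) := (measurePreserving_complexGaussian_smul zero_le_one
    (√(P.β i) : ℂ)).comp_hasLaw (hrow i)
  simp only [Complex.norm_real, Real.norm_eq_abs, sq_abs, Real.sq_sqrt (hβ _), mul_one] at hchan
  exact ((iIndepFun_curry (fun i j => (hlaw i j).aemeasurable) hindep).comp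
    (fun i z => (√(P.β i) : ℂ) • ∑ j, z j • EuclideanSpace.basisFun (Fin M) ℂ j)
    (by fun_prop)).hasLaw_pi hchan

lemma ae_linearIndependent_chan (hKM : K ≤ M) (hβ : ∀ i, 0 < P.β i)
    (hlaw : ∀ i j, HasLaw (h i j) stdComplexGaussian μ)
    (hindep : iIndepFun (fun q : Fin K × Fin M => h q.1 q.2) μ) :
    ∀ᵐ ω ∂μ, LinearIndependent ℂ fun i => chan P h i ω := by
  refine ((hasLaw_chan (fun i => (hβ i).le) hlaw hindep).ae_iff
    (measurableSet_setOfPred.1 isOpen_setOfPred_linearIndependent.measurableSet)).2 ?_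
  exact ae_linearIndependent_gaussianFamily hβ (by simpa using hKM)

lemma integrable_norm_chan_sq (hβ : ∀ i, 0 ≤ P.β i)
    (hlaw : ∀ i j, HasLaw (h i j) stdComplexGaussian μ)
    (hindep : iIndepFun (fun q : Fin K × Fin M => h q.1 q.2) μ) (i : Fin K) :
    Integrable (fun ω => ‖chan P h i ω‖ ^ 2) μ := by
  have hL := hasLaw_chan hβ hlaw hindep
  have hint : Integrable (fun v => ‖v i‖ ^ 2)
      (gaussianFamily (EuclideanSpace ℂ (Fin M)) P.β) :=
    integrable_comp_eval (μ := fun i => complexGaussian _ (P.β i))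
      integrable_norm_sq_complexGaussian
  rw [← hL.map_eq] at hint
  exact hint.comp_aemeasurable hL.aemeasurable

end Channel

section Downlink

lemma integrable_norm_mul_sq_of_indepFun {Ω : Type*} [MeasurableSpace Ω] {μ : Measure Ω}
    {X Y : Ω → ℂ} (hXY : IndepFun X Y μ) (hX : Integrable (fun ω => ‖X ω‖ ^ 2) μ)
    (hY : Integrable (fun ω => ‖Y ω‖ ^ 2) μ) : Integrable (fun ω => ‖X ω * Y ω‖ ^ 2) μ := by
  simp only [norm_mul, mul_pow]
  exact (hXY.comp (measurable_norm.pow_const 2) (measurable_norm.pow_const 2)).integrable_mul hX hY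

lemma integral_norm_mul_sq_of_indepFun {Ω : Type*} [MeasurableSpace Ω] {μ : Measure Ω}
    {X Y : Ω → ℂ} (hXY : IndepFun X Y μ) (hX : AEStronglyMeasurable (fun ω => ‖X ω‖ ^ 2) μ)
    (hY : AEStronglyMeasurable (fun ω => ‖Y ω‖ ^ 2) μ) :
    ∫ ω, ‖X ω * Y ω‖ ^ 2 ∂μ = (∫ ω, ‖X ω‖ ^ 2 ∂μ) * ∫ ω, ‖Y ω‖ ^ 2 ∂μ := by
  simp only [norm_mul, mul_pow]
  exact (hXY.comp (measurable_norm.pow_const 2)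
    (measurable_norm.pow_const 2)).integral_fun_mul_eq_mul_integral hX hY

variable {M K : ℕ} {Ω : Type*} {P : Params K} {h : Fin K → Fin M → Ω → ℂ} {s : Ω → ℂ}

lemma rxSignal_eq_sum_beamGain_mul (P : Params K) (h : Fin K → Fin M → Ω → ℂ) (s : Ω → ℂ)
    (i : Fin K) (ω : Ω) :
    rxSignal P h s i ω
      = (∑ j, √(P.ζ j) • beamGain (fun k => chan P h k ω) i j) * s ω := by
  have hbeam (j : Fin K) : ((√(P.ζ j) / ‖chan P h j ω‖ : ℝ) : ℂ) • chan P h j ω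
      = (√(P.ζ j) : ℂ) • NormedSpace.normalize (chan P h j ω) := by
    rw [NormedSpace.normalize, ← Complex.coe_smul, smul_smul, div_eq_mul_inv, Complex.ofReal_mul]
  simp only [rxSignal, precoder, hbeam, inner_sum, inner_smul_right, beamGain, Complex.real_smul]

variable [MeasurableSpace Ω] {μ : Measure Ω}

lemma integrable_norm_sum_smul_beamGain_chan_sq (hβ : ∀ i, 0 ≤ P.β i)
    (hlaw : ∀ i j, HasLaw (h i j) stdComplexGaussian μ)
    (hindep : iIndepFun (fun q : Fin K × Fin M => h q.1 q.2) μ) (c : Fin K → ℝ) (i : Fin K) :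
    Integrable (fun ω => ‖∑ j, c j • beamGain (fun k => chan P h k ω) i j‖ ^ 2) μ := by
  have hL := hasLaw_chan hβ hlaw hindep
  have hint := integrable_norm_sum_smul_beamGain_sq (E := EuclideanSpace ℂ (Fin M)) (β := P.β) c i
  rw [← hL.map_eq] at hint
  exact hint.comp_aemeasurable hL.aemeasurable

lemma integral_norm_sum_smul_beamGain_chan_sq (hM : 0 < M) (hβ : ∀ i, 0 < P.β i)
    (hlaw : ∀ i j, HasLaw (h i j) stdComplexGaussian μ)
    (hindep : iIndepFun (fun q : Fin K × Fin M => h q.1 q.2) μ) (c : Fin K → ℝ) (i : Fin K) :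
    ∫ ω, ‖∑ j, c j • beamGain (fun k => chan P h k ω) i j‖ ^ 2 ∂μ
      = P.β i * (c i ^ 2 * M + ∑ j ∈ Finset.univ.erase i, c j ^ 2) := by
  have : Nonempty (Fin M) := ⟨⟨0, hM⟩⟩
  have h := integral_norm_sum_smul_beamGain_sq (E := EuclideanSpace ℂ (Fin M)) hβ c i
  rw [finrank_euclideanSpace_fin] at h
  rw [← h]
  exact (hasLaw_chan (fun i => (hβ i).le) hlaw hindep).integral_comp
    (integrable_norm_sum_smul_beamGain_sq c i).aestronglyMeasurable

lemma indepFun_sum_smul_beamGain_chan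
    (hsindep : IndepFun s (fun ω (q : Fin K × Fin M) => h q.1 q.2 ω) μ) (c : Fin K → ℝ)
    (i : Fin K) :
    IndepFun (fun ω => ∑ j, c j • beamGain (fun k => chan P h k ω) i j) s μ := by
  have hchan : Measurable fun (z : Fin K × Fin M → ℂ) k =>
      chan P (fun i j (z : Fin K × Fin M → ℂ) => z (i, j)) k z := by
    simp only [chan_eq_smul_sum]
    fun_prop
  have hgain : Measurable fun v : Fin K → EuclideanSpace ℂ (Fin M) =>
      ∑ j, c j • beamGain v i j :=
    Finset.measurable_fun_sum _ fun j _ => (measurable_beamGain i j).const_smul (c j)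
  exact hsindep.symm.comp (hgain.comp hchan) measurable_id

lemma integrable_norm_rxSignal_sq (hβ : ∀ i, 0 ≤ P.β i)
    (hlaw : ∀ i j, HasLaw (h i j) stdComplexGaussian μ)
    (hindep : iIndepFun (fun q : Fin K × Fin M => h q.1 q.2) μ)
    (hs : Integrable (fun ω => ‖s ω‖ ^ 2) μ)
    (hsindep : IndepFun s (fun ω (q : Fin K × Fin M) => h q.1 q.2 ω) μ) (i : Fin K) :
    Integrable (fun ω => ‖rxSignal P h s i ω‖ ^ 2) μ := by
  simp only [rxSignal_eq_sum_beamGain_mul]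
  exact integrable_norm_mul_sq_of_indepFun (indepFun_sum_smul_beamGain_chan hsindep _ i)
    (integrable_norm_sum_smul_beamGain_chan_sq hβ hlaw hindep _ i) hs

lemma rxEnergy_eq (hM : 0 < M) (hζ : ∀ i, 0 ≤ P.ζ i) (hζsum : ∑ i, P.ζ i = 1)
    (hβ : ∀ i, 0 < P.β i) (hlaw : ∀ i j, HasLaw (h i j) stdComplexGaussian μ)
    (hindep : iIndepFun (fun q : Fin K × Fin M => h q.1 q.2) μ)
    (hs : AEStronglyMeasurable (fun ω => ‖s ω‖ ^ 2) μ) (hspow : ∫ ω, ‖s ω‖ ^ 2 ∂μ = P.pdl)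
    (hsindep : IndepFun s (fun ω (q : Fin K × Fin M) => h q.1 q.2 ω) μ) (i : Fin K) :
    rxEnergy μ P h s i = P.αWET * P.pdl * P.β i * (P.ζ i * (M : ℝ) + (1 - P.ζ i)) := by
  have hgain := integrable_norm_sum_smul_beamGain_chan_sq (fun i => (hβ i).le) hlaw hindep
    (fun j => √(P.ζ j)) i
  have hζrest : ∑ j ∈ Finset.univ.erase i, P.ζ j = 1 - P.ζ i := by
    rw [← hζsum, ← Finset.add_sum_erase _ P.ζ (Finset.mem_univ i), add_sub_cancel_left]
  simp only [rxEnergy, rxSignal_eq_sum_beamGain_mul]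
  rw [integral_norm_mul_sq_of_indepFun (indepFun_sum_smul_beamGain_chan hsindep _ i)
    hgain.aestronglyMeasurable hs, hspow,
    integral_norm_sum_smul_beamGain_chan_sq hM hβ hlaw hindep]
  simp only [Real.sq_sqrt (hζ _), hζrest]
  ring

end Downlink

section JensenBound

variable {Ω : Type*} [MeasurableSpace Ω] {μ : Measure Ω} {X : Ω → ℝ}

lemma log_one_add_inv_tangent_le {x m : ℝ} (hx : 0 < x) (hm : 0 < m) :
    Real.log (1 + m⁻¹) - (x - m) / (m * (m + 1)) ≤ Real.log (1 + x⁻¹) := by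
  have hlog : Real.log (1 + m⁻¹) - Real.log (1 + x⁻¹) ≤ (1 + m⁻¹) / (1 + x⁻¹) - 1 := by
    rw [← Real.log_div (by positivity) (by positivity)]
    exact Real.log_le_sub_one_of_pos (by positivity)
  have hratio : (1 + m⁻¹) / (1 + x⁻¹) - 1 = (x - m) / (m * (x + 1)) := by
    field_simp
    ring
  have htangent : (x - m) / (m * (x + 1)) ≤ (x - m) / (m * (m + 1)) := by
    rw [div_le_div_iff₀ (by positivity) (by positivity)]
    nlinarith [mul_nonneg hm.le (sq_nonneg (x - m))]
  linarith

lemma integrable_log_one_add (hX : Integrable X μ) (hX0 : 0 ≤ᵐ[μ] X) :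
    Integrable (fun ω => Real.log (1 + X ω)) μ := by
  refine hX.mono' (hX.aemeasurable.const_add 1).log.aestronglyMeasurable ?_
  filter_upwards [hX0] with ω hω
  have hω : 0 ≤ X ω := hω
  rw [Real.norm_of_nonneg (Real.log_nonneg (by linarith))]
  linarith [Real.log_le_sub_one_of_pos (x := 1 + X ω) (by linarith)]

lemma log_one_add_inv_integral_inv_le [IsProbabilityMeasure μ] (hX : Integrable X μ)
    (hpos : ∀ᵐ ω ∂μ, 0 < X ω) (hinv : Integrable (fun ω => (X ω)⁻¹) μ) :
    Real.log (1 + (∫ ω, (X ω)⁻¹ ∂μ)⁻¹) ≤ ∫ ω, Real.log (1 + X ω) ∂μ := by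
  have hinv_pos : ∀ᵐ ω ∂μ, 0 < (X ω)⁻¹ := hpos.mono fun ω => inv_pos.2
  set m := ∫ ω, (X ω)⁻¹ ∂μ with hm
  have hm_pos : 0 < m := by
    rw [hm, integral_pos_iff_support_of_nonneg_ae (hinv_pos.mono fun ω => le_of_lt) hinv,
      (prob_compl_eq_zero_iff₀ hinv.1.nullMeasurableSet_support).1 ?_]
    · exact one_pos
    · exact hinv_pos.mono fun ω => ne_of_gt
  have htangent : ∀ᵐ ω ∂μ, Real.log (1 + m⁻¹) - ((X ω)⁻¹ - m) / (m * (m + 1))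
      ≤ Real.log (1 + X ω) := by
    filter_upwards [hinv_pos] with ω hω
    simpa using log_one_add_inv_tangent_le hω hm_pos
  have hslope : Integrable (fun ω => ((X ω)⁻¹ - m) / (m * (m + 1))) μ :=
    (hinv.sub (integrable_const m)).div_const _
  calc Real.log (1 + m⁻¹)
      = ∫ ω, (Real.log (1 + m⁻¹) - ((X ω)⁻¹ - m) / (m * (m + 1))) ∂μ := by
        rw [integral_sub (integrable_const _) hslope, integral_div,
          integral_sub hinv (integrable_const m)]
        simp [← hm]
    _ ≤ ∫ ω, Real.log (1 + X ω) ∂μ :=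
        integral_mono_ae ((integrable_const _).sub hslope)
          (integrable_log_one_add hX (hpos.mono fun ω => le_of_lt)) htangent

lemma log_one_add_inv_lintegral_inv_le [IsProbabilityMeasure μ] (hX : Integrable X μ)
    (hX0 : 0 ≤ᵐ[μ] X) :
    Real.log (1 + (∫⁻ ω, (ENNReal.ofReal (X ω))⁻¹ ∂μ)⁻¹.toReal)
      ≤ ∫ ω, Real.log (1 + X ω) ∂μ := by
  by_cases htop : ∫⁻ ω, (ENNReal.ofReal (X ω))⁻¹ ∂μ = ⊤
  · simp only [htop, ENNReal.inv_top, ENNReal.toReal_zero, add_zero, Real.log_one]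
    refine integral_nonneg_of_ae (hX0.mono fun ω hω => Real.log_nonneg ?_)
    exact le_add_of_nonneg_right hω
  have hmeas : AEMeasurable (fun ω => (ENNReal.ofReal (X ω))⁻¹) μ :=
    hX.aemeasurable.ennreal_ofReal.inv
  have hpos : ∀ᵐ ω ∂μ, 0 < X ω := by
    filter_upwards [ae_lt_top' hmeas htop] with ω hω
    simpa using hω
  have hofReal : ∀ᵐ ω ∂μ, (ENNReal.ofReal (X ω))⁻¹ = ENNReal.ofReal (X ω)⁻¹ :=
    hpos.mono fun ω hω => (ENNReal.ofReal_inv_of_pos hω).symm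
  have hinv_nonneg : 0 ≤ᵐ[μ] fun ω => (X ω)⁻¹ := hX0.mono fun ω => inv_nonneg.2
  have hinv_meas : AEStronglyMeasurable (fun ω => (X ω)⁻¹) μ :=
    hX.aemeasurable.inv.aestronglyMeasurable
  rw [lintegral_congr_ae hofReal] at htop ⊢
  have h := log_one_add_inv_integral_inv_le hX hpos
    ((lintegral_ofReal_ne_top_iff_integrable hinv_meas hinv_nonneg).1 htop)
  rwa [integral_eq_lintegral_of_nonneg_ae hinv_nonneg hinv_meas, ← ENNReal.toReal_inv] at h

end JensenBound

section ZeroForcing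

variable {M K : ℕ} {Ω : Type*} {P : Params K} {h : Fin K → Fin M → Ω → ℂ} {p : Fin K → ℝ}

lemma zfVector_eq_dualFamily (P : Params K) (h : Fin K → Fin M → Ω → ℂ) (i : Fin K) (ω : Ω) :
    zfVector P h i ω = dualFamily ℂ (fun k => chan P h k ω) i := by
  have hgram : (chanMatrix P h ω).conjTranspose * chanMatrix P h ω
      = Matrix.gram ℂ fun k => chan P h k ω := by
    ext i j
    simp [Matrix.mul_apply, Matrix.gram_apply, chanMatrix, PiLp.inner_apply, mul_comm]
  ext j
  rw [zfVector, hgram]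
  simp [dualFamily, chanMatrix, Matrix.mul_apply, mul_comm]

lemma sinr_eq (p : Fin K → ℝ) {ω : Ω} (hli : LinearIndependent ℂ fun k => chan P h k ω)
    (i : Fin K) :
    sinr P h p i ω = p i / P.σ2 * (‖dualFamily ℂ (fun k => chan P h k ω) i‖ ^ 2)⁻¹ := by
  have hinterf : ∑ j ∈ Finset.univ.erase i,
      p j * ‖inner ℂ (zfVector P h i ω) (chan P h j ω)‖ ^ 2 = 0 := by
    refine Finset.sum_eq_zero fun j hj => ?_
    rw [zfVector_eq_dualFamily, inner_dualFamily hli, if_neg (Finset.ne_of_mem_erase hj).symm]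
    simp
  rw [sinr, hinterf, zfVector_eq_dualFamily, inner_dualFamily_self hli, norm_one, one_pow, mul_one,
    zero_add, div_mul_eq_div_div, div_eq_mul_inv]

lemma sinr_nonneg (hσ : 0 ≤ P.σ2) (hp : ∀ j, 0 ≤ p j) (i : Fin K) (ω : Ω) :
    0 ≤ sinr P h p i ω :=
  div_nonneg (mul_nonneg (hp i) (sq_nonneg _)) (add_nonneg
    (Finset.sum_nonneg fun j _ => mul_nonneg (hp j) (sq_nonneg _)) (mul_nonneg hσ (sq_nonneg _)))

variable [MeasurableSpace Ω] {μ : Measure Ω}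

lemma integrable_inv_norm_dualFamily_chan_sq (hKM : K ≤ M) (hβ : ∀ i, 0 < P.β i)
    (hlaw : ∀ i j, HasLaw (h i j) stdComplexGaussian μ)
    (hindep : iIndepFun (fun q : Fin K × Fin M => h q.1 q.2) μ) (i : Fin K) :
    Integrable (fun ω => (‖dualFamily ℂ (fun k => chan P h k ω) i‖ ^ 2)⁻¹) μ := by
  refine (integrable_norm_chan_sq (fun i => (hβ i).le) hlaw hindep i).mono'
    (((measurable_dualFamily i).norm.pow_const 2).inv.comp_aemeasurable
      (hasLaw_chan (fun i => (hβ i).le) hlaw hindep).aemeasurable).aestronglyMeasurable ?_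
  filter_upwards [ae_linearIndependent_chan hKM hβ hlaw hindep] with ω hω
  rw [Real.norm_of_nonneg (by positivity),
    inv_le_iff_one_le_mul₀' (pow_pos (norm_dualFamily_pos hω i) 2), ← mul_pow]
  exact one_le_pow₀ (one_le_norm_dualFamily_mul_norm hω i)

lemma integrable_sinr (hKM : K ≤ M) (hβ : ∀ i, 0 < P.β i)
    (hlaw : ∀ i j, HasLaw (h i j) stdComplexGaussian μ)
    (hindep : iIndepFun (fun q : Fin K × Fin M => h q.1 q.2) μ) (p : Fin K → ℝ) (i : Fin K) :
    Integrable (sinr P h p i) μ := by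
  refine ((integrable_inv_norm_dualFamily_chan_sq hKM hβ hlaw hindep i).const_mul
    (p i / P.σ2)).congr ?_
  filter_upwards [ae_linearIndependent_chan hKM hβ hlaw hindep] with ω hω
  rw [sinr_eq p hω]

lemma lintegral_norm_dualFamily_chan_sq (hKM : K < M) (hβ : ∀ i, 0 < P.β i)
    (hlaw : ∀ i j, HasLaw (h i j) stdComplexGaussian μ)
    (hindep : iIndepFun (fun q : Fin K × Fin M => h q.1 q.2) μ) (i : Fin K) :
    ∫⁻ ω, ENNReal.ofReal (‖dualFamily ℂ (fun k => chan P h k ω) i‖ ^ 2) ∂μ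
      = ENNReal.ofReal (P.β i * ((M : ℝ) - K))⁻¹ := by
  have h := lintegral_norm_dualFamily_sq (E := EuclideanSpace ℂ (Fin M)) hβ (by simpa using hKM) i
  rw [finrank_euclideanSpace_fin, Fintype.card_fin] at h
  rw [← h]
  exact (hasLaw_chan (fun i => (hβ i).le) hlaw hindep).lintegral_comp
    ((measurable_dualFamily i).norm.pow_const 2).ennreal_ofReal.aemeasurable

lemma lintegral_inv_sinr (hKM : K < M) (hσ : 0 < P.σ2) (hβ : ∀ i, 0 < P.β i)
    (hlaw : ∀ i j, HasLaw (h i j) stdComplexGaussian μ)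
    (hindep : iIndepFun (fun q : Fin K × Fin M => h q.1 q.2) μ) {i : Fin K} (hp : 0 < p i) :
    ∫⁻ ω, (ENNReal.ofReal (sinr P h p i ω))⁻¹ ∂μ
      = (ENNReal.ofReal (p i * P.β i * ((M : ℝ) - K) / P.σ2))⁻¹ := by
  have hMK : (0 : ℝ) < (M : ℝ) - K := sub_pos.2 (by exact_mod_cast hKM)
  have hb := hβ i
  have hinv : ∀ᵐ ω ∂μ, (ENNReal.ofReal (sinr P h p i ω))⁻¹
      = ENNReal.ofReal (P.σ2 / p i)
        * ENNReal.ofReal (‖dualFamily ℂ (fun k => chan P h k ω) i‖ ^ 2) := by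
    filter_upwards [ae_linearIndependent_chan hKM.le hβ hlaw hindep] with ω hω
    have hpos := norm_dualFamily_pos hω i
    rw [sinr_eq p hω, ← ENNReal.ofReal_inv_of_pos (by positivity), mul_inv, inv_inv, inv_div,
      ENNReal.ofReal_mul (by positivity)]
  rw [lintegral_congr_ae hinv, lintegral_const_mul' _ _ ENNReal.ofReal_ne_top,
    lintegral_norm_dualFamily_chan_sq hKM hβ hlaw hindep, ← ENNReal.ofReal_mul (by positivity),
    ← ENNReal.ofReal_inv_of_pos (by positivity)]
  congr 1
  field_simp

end ZeroForcing

section Rates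

variable {M K : ℕ} {Ω : Type*} [MeasurableSpace Ω] {μ : Measure Ω} {P : Params K}
  {h : Fin K → Fin M → Ω → ℂ} {s : Ω → ℂ}

lemma integrable_instRate (hKM : K ≤ M) (hσ : 0 ≤ P.σ2) (hβ : ∀ i, 0 < P.β i)
    (hlaw : ∀ i j, HasLaw (h i j) stdComplexGaussian μ)
    (hindep : iIndepFun (fun q : Fin K × Fin M => h q.1 q.2) μ)
    (hul : ∀ j, 0 ≤ ulEnergy μ P h s j) (i : Fin K) :
    Integrable (instRate μ P h s i) μ :=
  ((integrable_log_one_add (integrable_sinr hKM hβ hlaw hindep _ i)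
    (ae_of_all _ (sinr_nonneg hσ hul i))).div_const _).const_mul _

lemma achievableRate_le_ergodicRate (hKM : K ≤ M) (hB : 0 ≤ P.B) (hWIT : 0 ≤ P.αWIT)
    (hσ : 0 ≤ P.σ2) (hβ : ∀ i, 0 < P.β i) (hlaw : ∀ i j, HasLaw (h i j) stdComplexGaussian μ)
    (hindep : iIndepFun (fun q : Fin K × Fin M => h q.1 q.2) μ)
    (hul : ∀ j, 0 ≤ ulEnergy μ P h s j) (i : Fin K) :
    achievableRate μ P h s i ≤ ergodicRate μ P h s i := by
  have := hindep.isProbabilityMeasure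
  simp only [achievableRate, ergodicRate, instRate, Real.logb, integral_const_mul, integral_div]
  gcongr
  exact log_one_add_inv_lintegral_inv_le (integrable_sinr hKM hβ hlaw hindep _ i)
    (ae_of_all _ (sinr_nonneg hσ hul i))

lemma achievableRate_eq (hKM : K < M) (hσ : 0 < P.σ2) (hβ : ∀ i, 0 < P.β i)
    (hlaw : ∀ i j, HasLaw (h i j) stdComplexGaussian μ)
    (hindep : iIndepFun (fun q : Fin K × Fin M => h q.1 q.2) μ) {i : Fin K}
    (hul : 0 ≤ ulEnergy μ P h s i) :
    achievableRate μ P h s i = P.αWIT * P.B * Real.logb 2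
      (1 + ulEnergy μ P h s i * P.β i * ((M : ℝ) - K) / P.σ2) := by
  have := hindep.isProbabilityMeasure
  have hMK : (0 : ℝ) < (M : ℝ) - K := sub_pos.2 (by exact_mod_cast hKM)
  have hb := hβ i
  rcases hul.eq_or_lt with hzero | hpos
  · simp [achievableRate, sinr, ← hzero]
  · rw [achievableRate, lintegral_inv_sinr hKM hσ hβ hlaw hindep hpos, inv_inv,
      ENNReal.toReal_ofReal (by positivity)]

end Rates

section HarvestingRegimes

variable {K : ℕ} {P : Params K}

lemma harvest_eq_zero (hB : 0 ≤ P.B) (hθ : P.θact ≤ P.θsat) {γ : ℝ} (hγ : γ < P.θact / P.B) :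
    harvest P γ = 0 := by
  have hsat : P.θact / P.B ≤ P.θsat / P.B := div_le_div_of_nonneg_right hθ hB
  simp [harvest, hγ, hγ.trans_le hsat]

lemma harvest_eq_linear {γ : ℝ} (hact : P.θact / P.B ≤ γ) (hsat : γ < P.θsat / P.B) :
    harvest P γ = P.ηEH * γ := by
  simp [harvest, hact, hsat]

lemma harvest_eq_saturated {γ : ℝ} (hsat : P.θsat / P.B ≤ γ) :
    harvest P γ = P.ηEH * P.θsat / P.B := by
  simp [harvest, hsat.not_gt, hsat]

lemma harvest_nonneg (hB : 0 ≤ P.B) (hηEH : 0 ≤ P.ηEH) (hθact : 0 ≤ P.θact)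
    (hθsat : 0 ≤ P.θsat) (γ : ℝ) : 0 ≤ harvest P γ :=
  add_nonneg
    (Set.indicator_nonneg (fun _ hx => mul_nonneg hηEH ((div_nonneg hθact hB).trans hx.1)) γ)
    (Set.indicator_nonneg (fun _ _ => div_nonneg (mul_nonneg hηEH hθsat) hB) γ)

lemma ulEnergy_nonneg {M : ℕ} {Ω : Type*} [MeasurableSpace Ω] (μ : Measure Ω)
    (h : Fin K → Fin M → Ω → ℂ) (s : Ω → ℂ) {i : Fin K} (hWIT : 0 ≤ P.αWIT)
    (hηPA : 0 ≤ P.ηPA) (hξ : P.ξ i ≤ 1) (hharvest : ∀ γ, 0 ≤ harvest P γ) :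
    0 ≤ ulEnergy μ P h s i :=
  div_nonneg (mul_nonneg (mul_nonneg hηPA (sub_nonneg.2 hξ)) (hharvest _)) hWIT

lemma lt_antennaThreshold_iff {M : ℕ} {i : Fin K} (hB : 0 < P.B) (hWET : 0 < P.αWET)
    (hpdl : 0 < P.pdl) (hζ : 0 < P.ζ i) (hβ : 0 < P.β i) (θ : ℝ) :
    (M : ℤ) < antennaThreshold P θ i ↔
      P.αWET * P.pdl * P.β i * (P.ζ i * (M : ℝ) + (1 - P.ζ i)) < θ / P.B := by
  have hPdl : 0 < P.Pdl := by unfold Params.Pdl; positivity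
  rw [antennaThreshold, Int.lt_ceil, Int.cast_natCast, ← sub_lt_iff_lt_add', one_div,
    ← div_eq_inv_mul, lt_div_iff₀ hζ, lt_sub_iff_add_lt, lt_div_iff₀ (by positivity),
    lt_div_iff₀ hB, Params.Pdl]
  ring_nf

lemma antennaThreshold_le_iff {M : ℕ} {i : Fin K} (hB : 0 < P.B) (hWET : 0 < P.αWET)
    (hpdl : 0 < P.pdl) (hζ : 0 < P.ζ i) (hβ : 0 < P.β i) (θ : ℝ) :
    antennaThreshold P θ i ≤ (M : ℤ) ↔
      θ / P.B ≤ P.αWET * P.pdl * P.β i * (P.ζ i * (M : ℝ) + (1 - P.ζ i)) := by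
  rw [← not_lt, lt_antennaThreshold_iff hB hWET hpdl hζ hβ, not_lt]

lemma rho_eq (P : Params K) (hB : P.B ≠ 0) (i : Fin K) :
    rho P i
      = P.Pdl * (1 - P.ξ i) * P.ηEH * P.ηPA * P.β i ^ 2 / (P.B * P.αWIT * P.σ2) := by
  rw [rho, Params.Pdl]
  field_simp

lemma rho_mul_of_equal_allocation {i : Fin K} (hζ : P.ζ i = 1 / (K : ℝ)) (m x : ℝ) :
    rho P i * x * (1 + (m - 1) / K)
      = (1 - P.ξ i) * P.β i * P.ηPA *
        (P.ηEH * (P.αWET * P.pdl * P.β i * (P.ζ i * m + (1 - P.ζ i))) / (P.αWIT * P.σ2)) * x := by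
  rw [rho, hζ]
  ring

end HarvestingRegimes

end WirelessPower

theorem mainTheorem6 {M K : ℕ} (hKM : K < M)
    {Ω : Type*} [MeasurableSpace Ω] (μ : Measure Ω) [IsProbabilityMeasure μ]
    (P : WirelessPower.Params K)
    (hB : 0 < P.B) (hWET : 0 < P.αWET) (hWIT : 0 < P.αWIT) (hα : P.αWET + P.αWIT < 1)
    (hpdl : 0 < P.pdl) (hσ : 0 < P.σ2)
    (hθact : 0 < P.θact) (hθ : P.θact ≤ P.θsat)
    (hηEH : P.ηEH ∈ Set.Ioc (0 : ℝ) 1) (hηPA : P.ηPA ∈ Set.Ioc (0 : ℝ) 1)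
    (hζ : ∀ i, 0 < P.ζ i) (hζsum : ∑ i, P.ζ i = 1)
    (hβ : ∀ i, 0 < P.β i) (hξ : ∀ i, P.ξ i ∈ Set.Ioo (0 : ℝ) 1)
    -- i.i.d. Rayleigh fading: the coefficients are independent with law `CN(0,1)`
    (h : Fin K → Fin M → Ω → ℂ)
    (hlaw : ∀ i j, HasLaw (h i j) WirelessPower.stdComplexGaussian μ)
    (hindep : iIndepFun (fun q : Fin K × Fin M => h q.1 q.2) μ)
    -- the downlink energy symbol, independent of the channel
    (s : Ω → ℂ) (hs : AEMeasurable s μ) (hspow : ∫ ω, ‖s ω‖ ^ 2 ∂μ = P.pdl)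
    (hsindep : IndepFun s (fun ω (q : Fin K × Fin M) => h q.1 q.2 ω) μ)
    (i : Fin K) :
    -- the average received energy
    (Integrable (fun ω => ‖WirelessPower.rxSignal P h s i ω‖ ^ 2) μ ∧
      WirelessPower.rxEnergy μ P h s i
        = P.αWET * P.pdl * P.β i * (P.ζ i * (M : ℝ) + (1 - P.ζ i))) ∧
    -- the achievable rate is a lower bound on the ergodic rate
    (Integrable (WirelessPower.instRate μ P h s i) μ ∧
      WirelessPower.achievableRate μ P h s i ≤ WirelessPower.ergodicRate μ P h s i) ∧
    -- its value in the three regimes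
    ((M : ℤ) < WirelessPower.Mact P i → WirelessPower.achievableRate μ P h s i = 0) ∧
    (WirelessPower.Mact P i ≤ (M : ℤ) → (M : ℤ) < WirelessPower.Msat P i →
      WirelessPower.achievableRate μ P h s i
        = P.αWIT * P.B * Real.logb 2 (1 + (1 - P.ξ i) * P.β i * P.ηPA *
            (P.ηEH * WirelessPower.rxEnergy μ P h s i / (P.αWIT * P.σ2)) *
            ((M : ℝ) - (K : ℝ)))) ∧
    (WirelessPower.Msat P i ≤ (M : ℤ) →
      WirelessPower.achievableRate μ P h s i
        = P.αWIT * P.B * Real.logb 2 (1 + (1 - P.ξ i) * P.β i * P.ηPA *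
            (P.ηEH * P.θsat / (P.B * P.αWIT * P.σ2)) * ((M : ℝ) - (K : ℝ)))) ∧
    -- equal energy allocation, linear regime
    (P.ζ i = 1 / (K : ℝ) → WirelessPower.Mact P i ≤ (M : ℤ) → (M : ℤ) < WirelessPower.Msat P i →
      WirelessPower.achievableRate μ P h s i
        = P.αWIT * P.B * Real.logb 2 (1 + WirelessPower.rho P i * ((M : ℝ) - (K : ℝ)) *
            (1 + ((M : ℝ) - 1) / (K : ℝ)))) ∧
    WirelessPower.rho P i
      = P.Pdl * (1 - P.ξ i) * P.ηEH * P.ηPA * P.β i ^ 2 / (P.B * P.αWIT * P.σ2) := by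
  have hs_sq : Integrable (fun ω => ‖s ω‖ ^ 2) μ :=
    not_imp_comm.1 integral_undef (hspow.trans_ne hpdl.ne')
  have hγ := WirelessPower.rxEnergy_eq (by omega) (fun j => (hζ j).le) hζsum hβ hlaw hindep
    hs_sq.aestronglyMeasurable hspow hsindep i
  have hul (j : Fin K) := WirelessPower.ulEnergy_nonneg μ h s hWIT.le hηPA.1.le (hξ j).2.le
    (WirelessPower.harvest_nonneg hB.le hηEH.1.le hθact.le (hθact.le.trans hθ))
  have hrate := WirelessPower.achievableRate_eq hKM hσ hβ hlaw hindep (hul i)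
  have below := WirelessPower.lt_antennaThreshold_iff (M := M) hB hWET hpdl (hζ i) (hβ i)
  have above := WirelessPower.antennaThreshold_le_iff (M := M) hB hWET hpdl (hζ i) (hβ i)
  rw [← hγ] at below above
  have hlinear (hact : WirelessPower.Mact P i ≤ M) (hsat : M < WirelessPower.Msat P i) :=
    WirelessPower.harvest_eq_linear ((above _).1 hact) ((below _).1 hsat)
  refine ⟨⟨WirelessPower.integrable_norm_rxSignal_sq (fun j => (hβ j).le) hlaw hindep hs_sq
      hsindep i, hγ⟩, ⟨WirelessPower.integrable_instRate hKM.le hσ.le hβ hlaw hindep hul i,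
    WirelessPower.achievableRate_le_ergodicRate hKM.le hB.le hWIT.le hσ.le hβ hlaw hindep hul i⟩,
    fun hact => ?_, fun hact hsat => ?_, fun hsat => ?_, fun hζK hact hsat => ?_,
    WirelessPower.rho_eq P hB.ne' i⟩
  · simp [hrate, WirelessPower.ulEnergy, WirelessPower.harvest_eq_zero hB.le hθ ((below _).1 hact)]
  · rw [hrate, WirelessPower.ulEnergy, hlinear hact hsat]
    ring_nf
  · rw [hrate, WirelessPower.ulEnergy, WirelessPower.harvest_eq_saturated ((above _).1 hsat)]
    ring_nf
  · rw [WirelessPower.rho_mul_of_equal_allocation hζK, ← hγ, hrate, WirelessPower.ulEnergy,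
      hlinear hact hsat]
    ring_nf
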